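/- Let $\mathcal V$ be a monoidal category (not assumed symmetric or closed) that has equalizers. A \emph{$\mathcal V$-enriched category} is a category $\mathcal E$ with a $\mathcal V$-enrichment: hom-objects $\mathcal E(x,y)\in\mathcal V$, identities $I\to\mathcal E(x,x)$ and compositions $\mathcal E(x,y)\otimes\mathcal E(y,z)\to\mathcal E(x,z)$ satisfying the unit and associativity laws, and bijections between morphisms $x\to y$ of $\mathcal E$ and morphisms $I\to\mathcal E(x,y)$ of $\mathcal V$ that are compatible with identities and composition. An \emph{enriched functor} is a functor $F$ with morphisms $\mathcal E_1(x,y)\to\mathcal E_2(Fx,Fy)$ that respect identities, composition and these bijections. An \emph{enriched transformation} $\tau:F\Rightarrow G$ is a natural transformation such that the composites $\mathcal E_1(x,y)\to\mathcal E_2(Gx,Gy)\to\mathcal E_2(Fx,Gy)$ (precomposition with $\tau_x$) and $\mathcal E_1(x,y)\to\mathcal E_2(Fx,Fy)\to\mathcal E_2(Fx,Gy)$ (postcomposition with $\tau_y$) agree. These form a bicategory $\mathrm{EnrichCat}(\mathcal V)$. (Here, as usual, the size of the collection of objects is at least the size of the hom-sets.) Call $\mathcal E$ \emph{univalent} if,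 for all objects $x,y$, the map sending an equality $x=y$ to an isomorphism $x\cong y$ of the underlying category is a bijection, and let $\mathrm{EnrichCat}_{\mathrm{univ}}(\mathcal V)$ be the full sub-bicategory on the univalent enriched categories. A \emph{monad} in a bicategory is a 1-cell $t:a\to a$ with 2-cells $\eta:\mathrm{id}\Rightarrow t$ and $\mu:t\cdot t\Rightarrow t$ (with $f\cdot g$ meaning first $f$, then $g$) satisfying the unit and associativity laws. A \emph{Kleisli cocone} is $(k,\ell:a\to k,\lambda:t\cdot\ell\Rightarrow\ell)$ compatible with $\eta$ and $\mu$. It is \emph{universal} if (i) for every Kleisli cocone $(q,\ell',\lambda')$ there are a 1-cell $g:k\to q$ and an invertible 2-cell $\ell\cdot g\cong\ell'$ compatible with $\lambda$ and $\lambda'$; and (ii) for all $g_1,g_2:k\to x$, every 2-cell $\tau:\ell\cdot g_1\Rightarrow\ell\cdot g_2$ compatible with $\lambda$ is the whiskering of $\ell$ with a unique 2-cell $g_1\Rightarrow g_2$. A bicategory \emph{has Kleisli objects} if every monad in it has a universal Kleisli cocone. Let $T$ be a monad in $\mathrm{EnrichCat}(\mathcal V)$ on $\mathcal E$. The Eilenberg–Moore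 category of $T$ is enriched by letting the hom-object from $(A,a)$ to $(B,b)$ be the equalizer of $\mathcal E(A,B)\xrightarrow{T}\mathcal E(TA,TB)\xrightarrow{b\circ-}\mathcal E(TA,B)$ and $\mathcal E(A,B)\xrightarrow{-\circ a}\mathcal E(TA,B)$. Let $\mathrm{Kl}(T)$ be its enriched full subcategory on the algebras that are isomorphic to a free algebra. Let $\mathrm{FKl}(T)$ be the enriched category with the objects of $\mathcal E$, hom-objects $\mathcal E(x,Ty)$, identities given by $\eta$ and the usual Kleisli composition. Then the following hold. 1. For every monad $T$ in $\mathrm{EnrichCat}(\mathcal V)$, the enriched category $\mathrm{Kl}(T)$, with the free algebra functor $\mathcal E\to\mathrm{Kl}(T)$ and the 2-cell whose component at $x$ is the algebra morphism $\mu_x:T(Tx)\to Tx$, is a universal Kleisli cocone for $T$. 2. The enriched functor $\mathrm{FKl}(T)\to\mathrm{Kl}(T)$ that sends $x$ to the free algebra on $x$ and acts on hom-objects by $\mathcal E(x,Ty)\xrightarrow{T}\mathcal E(Tx,T(Ty))\xrightarrow{\mu_y\circ-}\mathcal E(Tx,Ty)$ is a weak equivalence: it is essentially surjective and its actions on hom-objects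 are isomorphisms. 3. If $\mathcal E$ is univalent, then so is $\mathrm{Kl}(T)$; and for every monad $T$ in $\mathrm{EnrichCat}_{\mathrm{univ}}(\mathcal V)$ there is a universal Kleisli cocone in $\mathrm{EnrichCat}_{\mathrm{univ}}(\mathcal V)$ with vertex $\mathrm{Kl}(T)$. In particular, $\mathrm{EnrichCat}(\mathcal V)$ and $\mathrm{EnrichCat}_{\mathrm{univ}}(\mathcal V)$ have Kleisli objects. -/

import Mathlib

open CategoryTheory

universe v u v' u' v₁ v₂ v₃ u₁ u₂ u₃ w

namespace EnrichedKleisli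

/-! ### Monads and Kleisli objects in a bicategory -/

section Bicategorical

open Bicategory

/-- A monad in a bicategory `B`. -/
structure BicatMonad (B : Type u) [Bicategory.{w, v} B] where
  ob : B
  endo : ob ⟶ ob
  unit : 𝟙 ob ⟶ endo
  mult : endo ≫ endo ⟶ endo
  mult_unit_left : (ρ_ endo).inv ≫ endo ◁ unit ≫ mult = 𝟙 endo
  mult_unit_right : (λ_ endo).inv ≫ unit ▷ endo ≫ mult = 𝟙 endo
  mult_assoc : endo ◁ mult ≫ mult = (α_ endo endo endo).inv ≫ mult ▷ endo ≫ mult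

/-- A Kleisli cocone for a monad in a bicategory. -/
structure KleisliCocone {B : Type u} [Bicategory.{w, v} B] (m : BicatMonad B) where
  ob : B
  leg : m.ob ⟶ ob
  cell : m.endo ≫ leg ⟶ leg
  unit_cell : m.unit ▷ leg ≫ cell = (λ_ leg).hom
  mult_cell : m.mult ▷ leg ≫ cell = (α_ m.endo m.endo leg).hom ≫ m.endo ◁ cell ≫ cell

/-- The universal property of a Kleisli object: a one-dimensional part for cocones, and a
two-dimensional part for 2-cells between 1-cells out of the vertex. -/
structure KleisliCocone.IsUniversal {B : Type u} [Bicategory.{w, v} B] {m : BicatMonad B}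
    (k : KleisliCocone m) : Prop where
  exists_mor (q : KleisliCocone m) :
    ∃ (g : k.ob ⟶ q.ob) (c : k.leg ≫ g ≅ q.leg),
      (α_ m.endo k.leg g).inv ≫ k.cell ▷ g ≫ c.hom = m.endo ◁ c.hom ≫ q.cell
  existsUnique_cell (x : B) (g₁ g₂ : k.ob ⟶ x) (τ : k.leg ≫ g₁ ⟶ k.leg ≫ g₂)
    (hτ : (α_ m.endo k.leg g₁).inv ≫ k.cell ▷ g₁ ≫ τ =
      m.endo ◁ τ ≫ (α_ m.endo k.leg g₂).inv ≫ k.cell ▷ g₂) :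
    ∃! θ : g₁ ⟶ g₂, k.leg ◁ θ = τ

/-- A bicategory has Kleisli objects if every monad in it has a universal Kleisli cocone. -/
def HasKleisliObjects (B : Type u) [Bicategory.{w, v} B] : Prop :=
  ∀ m : BicatMonad B, ∃ k : KleisliCocone m, k.IsUniversal

/-- A monad in a full sub-bicategory, regarded as a monad in the ambient bicategory. -/
def BicatMonad.ofInduced {A : Type u₁} {B : Type u} [Bicategory.{w, v} B] {F : A → B}
    (m : BicatMonad (InducedBicategory B F)) : BicatMonad B where
  ob := F m.ob
  endo := m.endo.hom
  unit := m.unit.hom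
  mult := m.mult.hom
  mult_unit_left := congrArg InducedBicategory.Hom₂.hom m.mult_unit_left
  mult_unit_right := congrArg InducedBicategory.Hom₂.hom m.mult_unit_right
  mult_assoc := congrArg InducedBicategory.Hom₂.hom m.mult_assoc

end Bicategorical

/-! ### Enriched functors and enriched transformations

A category with a `V`-enrichment is `EnrichedOrdinaryCategory V C`: a category `C`, hom-objects,
enriched identities and composition, and a compatible bijection between morphisms `X ⟶ Y` of `C` and
morphisms `𝟙_ V ⟶ C(X, Y)` of `V`. The composition is written in diagrammatic order, as a morphism
`C(X, Y) ⊗ C(Y, Z) ⟶ C(X, Z)`. A `V`-naturality condition on hom-objects is part of the notion of an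
enriched transformation below; it does not follow from naturality on underlying categories. -/

section Enrichments

open MonoidalCategory

variable (V : Type u') [Category.{v'} V] [MonoidalCategory V]
  {C : Type u₁} [Category.{v₁} C] [EnrichedOrdinaryCategory V C]
  {D : Type u₂} [Category.{v₂} D] [EnrichedOrdinaryCategory V D]
  {E : Type u₃} [Category.{v₃} E] [EnrichedOrdinaryCategory V E]

/-- A `V`-enrichment of a functor between categories with `V`-enrichments. -/
structure FunctorEnrichment (F : C ⥤ D) where
  ehom (X Y : C) : (X ⟶[V] Y) ⟶ (F.obj X ⟶[V] F.obj Y)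
  ehom_id (X : C) : eId V X ≫ ehom X X = eId V (F.obj X)
  ehom_comp (X Y Z : C) :
    eComp V X Y Z ≫ ehom X Z =
      (ehom X Y ⊗ₘ ehom Y Z) ≫ eComp V (F.obj X) (F.obj Y) (F.obj Z)
  homEquiv_map {X Y : C} (f : X ⟶ Y) :
    eHomEquiv V (F.map f) = eHomEquiv V f ≫ ehom X Y

variable {V}

/-- The identity functor is enriched. -/
def FunctorEnrichment.id : FunctorEnrichment V (𝟭 C) where
  ehom X Y := 𝟙 _
  ehom_id X := Category.comp_id _
  ehom_comp X Y Z := by simp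
  homEquiv_map f := (Category.comp_id _).symm

/-- Enriched functors compose. -/
def FunctorEnrichment.comp {F : C ⥤ D} {G : D ⥤ E} (EF : FunctorEnrichment V F)
    (EG : FunctorEnrichment V G) : FunctorEnrichment V (F ⋙ G) where
  ehom X Y := EF.ehom X Y ≫ EG.ehom (F.obj X) (F.obj Y)
  ehom_id X := by rw [← Category.assoc, EF.ehom_id, EG.ehom_id]; rfl
  ehom_comp X Y Z := by
    rw [← Category.assoc, EF.ehom_comp, Category.assoc, EG.ehom_comp, ← Category.assoc,
      tensorHom_comp_tensorHom]
    rfl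
  homEquiv_map f := by
    rw [Functor.comp_map, EG.homEquiv_map, EF.homEquiv_map, Category.assoc]

/-- A natural transformation `τ : F ⟶ G` between functors with enrichments is `V`-enriched if the
two composites `C(X, Y) ⟶ D(G X, G Y) ⟶ D(F X, G Y)` (precomposition with `τ X`) and
`C(X, Y) ⟶ D(F X, F Y) ⟶ D(F X, G Y)` (postcomposition with `τ Y`) agree. -/
def IsEnriched {F G : C ⥤ D} (EF : FunctorEnrichment V F) (EG : FunctorEnrichment V G)
    (τ : F ⟶ G) : Prop :=
  ∀ X Y : C, EG.ehom X Y ≫ eHomWhiskerRight V (τ.app X) (G.obj Y) =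
    EF.ehom X Y ≫ eHomWhiskerLeft V (F.obj X) (τ.app Y)

namespace FunctorEnrichment

variable {F : C ⥤ D} (EF : FunctorEnrichment V F)

lemma whiskerLeft_ehom (X : C) {Y Y' : C} (f : Y ⟶ Y') :
    eHomWhiskerLeft V X f ≫ EF.ehom X Y' =
      EF.ehom X Y ≫ eHomWhiskerLeft V (F.obj X) (F.map f) := by
  simp only [eHomWhiskerLeft, Category.assoc, EF.ehom_comp, EF.homEquiv_map,
    MonoidalCategory.tensorHom_def]
  rw [MonoidalCategory.whisker_exchange_assoc]
  simp

lemma whiskerRight_ehom {X X' : C} (f : X ⟶ X') (Y : C) :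
    eHomWhiskerRight V f Y ≫ EF.ehom X Y =
      EF.ehom X' Y ≫ eHomWhiskerRight V (F.map f) (F.obj Y) := by
  simp only [eHomWhiskerRight, Category.assoc, EF.ehom_comp, EF.homEquiv_map,
    MonoidalCategory.tensorHom_def']
  rw [← MonoidalCategory.whisker_exchange_assoc]
  simp

end FunctorEnrichment

lemma isEnriched_id {F : C ⥤ D} (EF : FunctorEnrichment V F) : IsEnriched EF EF (𝟙 F) := by
  intro X Y; simp

lemma IsEnriched.comp {F G H : C ⥤ D} {EF : FunctorEnrichment V F} {EG : FunctorEnrichment V G}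
    {EH : FunctorEnrichment V H} {σ : F ⟶ G} {τ : G ⟶ H} (hσ : IsEnriched EF EG σ)
    (hτ : IsEnriched EG EH τ) : IsEnriched EF EH (σ ≫ τ) := by
  intro X Y
  rw [NatTrans.comp_app, NatTrans.comp_app, eHomWhiskerRight_comp, eHomWhiskerLeft_comp,
    ← Category.assoc, hτ X Y, Category.assoc, eHom_whisker_exchange, ← Category.assoc, hσ X Y,
    Category.assoc]

lemma IsEnriched.whiskerLeft {F : C ⥤ D} (EF : FunctorEnrichment V F) {G H : D ⥤ E}
    {EG : FunctorEnrichment V G} {EH : FunctorEnrichment V H} {τ : G ⟶ H}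
    (hτ : IsEnriched EG EH τ) :
    IsEnriched (EF.comp EG) (EF.comp EH) (Functor.whiskerLeft F τ) := by
  intro X Y
  have := hτ (F.obj X) (F.obj Y)
  simp [FunctorEnrichment.comp, this]

lemma IsEnriched.whiskerRight {F G : C ⥤ D} {EF : FunctorEnrichment V F}
    {EG : FunctorEnrichment V G} {τ : F ⟶ G} (hτ : IsEnriched EF EG τ) {H : D ⥤ E}
    (EH : FunctorEnrichment V H) :
    IsEnriched (EF.comp EH) (EG.comp EH) (Functor.whiskerRight τ H) := by
  intro X Y
  have := hτ X Y
  simp only [FunctorEnrichment.comp, Functor.whiskerRight_app, Category.assoc, Functor.comp_obj,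
    ← FunctorEnrichment.whiskerLeft_ehom, ← FunctorEnrichment.whiskerRight_ehom]
  rw [← Category.assoc, this, Category.assoc]

end Enrichments

/-! ### The bicategory of enriched categories -/

section EnrichCat

open MonoidalCategory

variable (V : Type u') [Category.{v'} V] [MonoidalCategory V]

/-- A category together with a `V`-enrichment. -/
structure EnrichCat where
  carrier : Type u
  [cat : Category.{v} carrier]
  [enr : EnrichedOrdinaryCategory V carrier]

attribute [instance] EnrichCat.cat EnrichCat.enr

variable {V}

/-- A functor together with a `V`-enrichment. -/
structure EnrichFunctor (C : EnrichCat.{v₁, u₁} V) (D : EnrichCat.{v₂, u₂} V) where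
  functor : C.carrier ⥤ D.carrier
  enrichment : FunctorEnrichment V functor

/-- A natural transformation that is `V`-enriched. -/
@[ext]
structure EnrichTrans {C : EnrichCat.{v₁, u₁} V} {D : EnrichCat.{v₂, u₂} V}
    (F G : EnrichFunctor C D) where
  nat : F.functor ⟶ G.functor
  isEnriched : IsEnriched F.enrichment G.enrichment nat

instance (C : EnrichCat.{v₁, u₁} V) (D : EnrichCat.{v₂, u₂} V) : Category (EnrichFunctor C D) where
  Hom F G := EnrichTrans F G
  id _ := ⟨𝟙 _, isEnriched_id _⟩
  comp σ τ := ⟨σ.nat ≫ τ.nat, σ.isEnriched.comp τ.isEnriched⟩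
  id_comp _ := EnrichTrans.ext (Category.id_comp _)
  comp_id _ := EnrichTrans.ext (Category.comp_id _)
  assoc _ _ _ := EnrichTrans.ext (Category.assoc _ _ _)

@[ext]
lemma EnrichTrans.hom_ext {C : EnrichCat.{v₁, u₁} V} {D : EnrichCat.{v₂, u₂} V}
    {F G : EnrichFunctor C D} {σ τ : F ⟶ G} (h : ∀ X, σ.nat.app X = τ.nat.app X) : σ = τ :=
  EnrichTrans.ext (NatTrans.ext (funext h))

@[simp]
lemma EnrichTrans.id_nat {C : EnrichCat.{v₁, u₁} V} {D : EnrichCat.{v₂, u₂} V}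
    (F : EnrichFunctor C D) : EnrichTrans.nat (𝟙 F) = 𝟙 F.functor := rfl

@[simp]
lemma EnrichTrans.comp_nat {C : EnrichCat.{v₁, u₁} V} {D : EnrichCat.{v₂, u₂} V}
    {F G H : EnrichFunctor C D} (σ : F ⟶ G) (τ : G ⟶ H) : (σ ≫ τ).nat = σ.nat ≫ τ.nat := rfl

/-- An isomorphism of enriched functors from a natural isomorphism that is enriched in both
directions. -/
@[simps]
def EnrichFunctor.isoMk {C : EnrichCat.{v₁, u₁} V} {D : EnrichCat.{v₂, u₂} V}
    {F G : EnrichFunctor C D} (e : F.functor ≅ G.functor)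
    (h : IsEnriched F.enrichment G.enrichment e.hom)
    (h' : IsEnriched G.enrichment F.enrichment e.inv) : F ≅ G where
  hom := ⟨e.hom, h⟩
  inv := ⟨e.inv, h'⟩
  hom_inv_id := EnrichTrans.ext e.hom_inv_id
  inv_hom_id := EnrichTrans.ext e.inv_hom_id

@[simps]
instance : CategoryStruct (EnrichCat.{v, u} V) where
  Hom C D := EnrichFunctor C D
  id C := ⟨𝟭 C.carrier, FunctorEnrichment.id⟩
  comp F G := ⟨F.functor ⋙ G.functor, F.enrichment.comp G.enrichment⟩

instance : Bicategory (EnrichCat.{v, u} V) where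
  homCategory C D := inferInstanceAs (Category (EnrichFunctor C D))
  whiskerLeft F _ _ τ := ⟨Functor.whiskerLeft F.functor τ.nat,
    τ.isEnriched.whiskerLeft F.enrichment⟩
  whiskerRight τ H := ⟨Functor.whiskerRight τ.nat H.functor,
    τ.isEnriched.whiskerRight H.enrichment⟩
  associator F G H := EnrichFunctor.isoMk (Functor.associator F.functor G.functor H.functor)
    (by intro X Y; simp [FunctorEnrichment.comp])
    (by intro X Y; simp [FunctorEnrichment.comp])
  leftUnitor F := EnrichFunctor.isoMk (Functor.leftUnitor F.functor)
    (by intro X Y; simp [FunctorEnrichment.comp, FunctorEnrichment.id])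
    (by intro X Y; simp [FunctorEnrichment.comp, FunctorEnrichment.id])
  rightUnitor F := EnrichFunctor.isoMk (Functor.rightUnitor F.functor)
    (by intro X Y; simp [FunctorEnrichment.comp, FunctorEnrichment.id])
    (by intro X Y; simp [FunctorEnrichment.comp, FunctorEnrichment.id])
  whiskerLeft_id F G := EnrichTrans.ext
    (show Functor.whiskerLeft F.functor (𝟙 G.functor) = 𝟙 _ by ext; simp)
  whiskerLeft_comp F _ _ _ σ τ := EnrichTrans.ext
    (show Functor.whiskerLeft F.functor (σ.nat ≫ τ.nat) = Functor.whiskerLeft F.functor σ.nat ≫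
      Functor.whiskerLeft F.functor τ.nat by ext; simp)
  id_whiskerLeft τ := EnrichTrans.ext
    (show Functor.whiskerLeft (𝟭 _) τ.nat = (Functor.leftUnitor _).hom ≫ τ.nat ≫
      (Functor.leftUnitor _).inv by ext; simp)
  comp_whiskerLeft F G _ _ τ := EnrichTrans.ext
    (show Functor.whiskerLeft (F.functor ⋙ G.functor) τ.nat = (Functor.associator _ _ _).hom ≫
      Functor.whiskerLeft F.functor (Functor.whiskerLeft G.functor τ.nat) ≫
      (Functor.associator _ _ _).inv by ext; simp)
  id_whiskerRight F G := EnrichTrans.ext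
    (show Functor.whiskerRight (𝟙 F.functor) G.functor = 𝟙 _ by ext; simp)
  comp_whiskerRight σ τ H := EnrichTrans.ext
    (show Functor.whiskerRight (σ.nat ≫ τ.nat) H.functor = Functor.whiskerRight σ.nat H.functor ≫
      Functor.whiskerRight τ.nat H.functor by ext; simp)
  whiskerRight_id τ := EnrichTrans.ext
    (show Functor.whiskerRight τ.nat (𝟭 _) = (Functor.rightUnitor _).hom ≫ τ.nat ≫
      (Functor.rightUnitor _).inv by ext; simp)
  whiskerRight_comp τ G H := EnrichTrans.ext
    (show Functor.whiskerRight τ.nat (G.functor ⋙ H.functor) = (Functor.associator _ _ _).inv ≫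
      Functor.whiskerRight (Functor.whiskerRight τ.nat G.functor) H.functor ≫
      (Functor.associator _ _ _).hom by ext; simp)
  whisker_assoc F _ _ τ H := EnrichTrans.ext
    (show Functor.whiskerRight (Functor.whiskerLeft F.functor τ.nat) H.functor =
      (Functor.associator _ _ _).hom ≫
      Functor.whiskerLeft F.functor (Functor.whiskerRight τ.nat H.functor) ≫
      (Functor.associator _ _ _).inv by ext; simp)
  whisker_exchange {_ _ _ F G H I} σ τ := EnrichTrans.ext
    (show Functor.whiskerLeft F.functor τ.nat ≫ Functor.whiskerRight σ.nat I.functor =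
      Functor.whiskerRight σ.nat H.functor ≫ Functor.whiskerLeft G.functor τ.nat by ext; simp)
  pentagon F G H I := EnrichTrans.ext
    (show Functor.whiskerRight (Functor.associator F.functor G.functor H.functor).hom I.functor ≫
      (Functor.associator F.functor (G.functor ⋙ H.functor) I.functor).hom ≫
      Functor.whiskerLeft F.functor (Functor.associator G.functor H.functor I.functor).hom =
      (Functor.associator (F.functor ⋙ G.functor) H.functor I.functor).hom ≫
      (Functor.associator F.functor G.functor (H.functor ⋙ I.functor)).hom by ext; simp)
  triangle F G := EnrichTrans.ext
    (show (Functor.associator F.functor (𝟭 _) G.functor).hom ≫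
      Functor.whiskerLeft F.functor (Functor.leftUnitor G.functor).hom =
      Functor.whiskerRight (Functor.rightUnitor F.functor).hom G.functor by ext; simp)

end EnrichCat
/-! ### Enriched monads, their Eilenberg–Moore and Kleisli categories -/

section EnrichedMonads

open MonoidalCategory Limits

variable (V : Type u') [Category.{v'} V] [MonoidalCategory V]

/-- The component `T (T X) ⟶ T X` of the multiplication of a monad. -/
def muApp {C : Type u₁} [Category.{v₁} C] (T : Monad C) (X : C) : T.obj (T.obj X) ⟶ T.obj X :=
  T.μ.app X

lemma map_muApp {C : Type u₁} [Category.{v₁} C] (T : Monad C) (X : C) :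
    T.map (muApp T X) ≫ muApp T X = muApp T (T.obj X) ≫ muApp T X := T.assoc X

lemma muApp_naturality {C : Type u₁} [Category.{v₁} C] (T : Monad C) {X Y : C} (f : X ⟶ Y) :
    T.map (T.map f) ≫ muApp T Y = muApp T X ≫ T.map f := T.μ.naturality f

lemma unit_muApp {C : Type u₁} [Category.{v₁} C] (T : Monad C) (X : C) :
    T.η.app (T.obj X) ≫ muApp T X = 𝟙 (T.obj X) := T.left_unit X

lemma map_unit_muApp {C : Type u₁} [Category.{v₁} C] (T : Monad C) (X : C) :
    T.map (T.η.app X) ≫ muApp T X = 𝟙 (T.obj X) := T.right_unit X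

/-- A `V`-enrichment of a monad: the endofunctor is enriched, and the unit and the multiplication
are `V`-enriched transformations. -/
structure MonadEnrichment {C : Type u₁} [Category.{v₁} C] [EnrichedOrdinaryCategory V C]
    (T : Monad C) where
  endo : FunctorEnrichment V T.toFunctor
  unit : IsEnriched FunctorEnrichment.id endo T.η
  mult : IsEnriched (endo.comp endo) endo T.μ

variable {V}
variable {C : Type u₁} [Category.{v₁} C] [EnrichedOrdinaryCategory V C]

/-- Enriched composition is dinatural in the middle object. -/
lemma eComp_dinatural (X : C) {Y Y' : C} (f : Y ⟶ Y') (Z : C) :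
    (X ⟶[V] Y) ◁ eHomWhiskerRight V f Z ≫ eComp V X Y Z =
      eHomWhiskerLeft V X f ▷ (Y' ⟶[V] Z) ≫ eComp V X Y' Z := by
  simp only [eHomWhiskerLeft, eHomWhiskerRight, MonoidalCategory.whiskerLeft_comp,
    comp_whiskerRight, Category.assoc]
  rw [← e_assoc V X Y Y' Z]
  simp

lemma rightUnitor_inv_tensor {P Q P' Q' R : V} (i : P ⟶ P') (k : Q ⟶ Q') (c : P' ⊗ Q' ⟶ R)
    (x : 𝟙_ V ⟶ Q) :
    (ρ_ P).inv ≫ P ◁ x ≫ (i ⊗ₘ k) ≫ c = i ≫ (ρ_ P').inv ≫ P' ◁ (x ≫ k) ≫ c := by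
  rw [MonoidalCategory.tensorHom_def', Category.assoc, ← MonoidalCategory.whiskerLeft_comp_assoc,
    MonoidalCategory.whisker_exchange_assoc, ← rightUnitor_inv_naturality_assoc]

lemma leftUnitor_inv_tensor {P Q P' Q' R : V} (i : P ⟶ P') (k : Q ⟶ Q') (c : P' ⊗ Q' ⟶ R)
    (x : 𝟙_ V ⟶ P) :
    (λ_ Q).inv ≫ x ▷ Q ≫ (i ⊗ₘ k) ≫ c = k ≫ (λ_ Q').inv ≫ (x ≫ i) ▷ Q' ≫ c := by
  rw [MonoidalCategory.tensorHom_def, Category.assoc, ← comp_whiskerRight_assoc,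
    ← MonoidalCategory.whisker_exchange_assoc, ← leftUnitor_inv_naturality_assoc]

lemma eHomEquiv_whiskerLeft {X Y Z : C} (f : X ⟶ Y) (g : Y ⟶ Z) :
    eHomEquiv V f ≫ eHomWhiskerLeft V X g = eHomEquiv V (f ≫ g) := by
  rw [eHomEquiv_comp, eHomWhiskerLeft, tensorHom_def_assoc, unitors_inv_equal,
    ← rightUnitor_inv_naturality_assoc]

lemma eHomEquiv_whiskerRight {X Y Z : C} (f : X ⟶ Y) (g : Y ⟶ Z) :
    eHomEquiv V g ≫ eHomWhiskerRight V f Z = eHomEquiv V (f ≫ g) := by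
  rw [eHomEquiv_comp, eHomWhiskerRight, tensorHom_def'_assoc,
    ← leftUnitor_inv_naturality_assoc]

namespace MonadEnrichment

variable {T : Monad C} (ET : MonadEnrichment V T)

lemma eHomEquiv_condition_iff {A B : T.Algebra} (f : A.A ⟶ B.A) :
    eHomEquiv V f ≫ ET.endo.ehom A.A B.A ≫ eHomWhiskerLeft V (T.obj A.A) B.a =
      eHomEquiv V f ≫ eHomWhiskerRight V A.a B.A ↔ T.map f ≫ B.a = A.a ≫ f := by
  rw [← Category.assoc, ← ET.endo.homEquiv_map, eHomEquiv_whiskerRight, eHomEquiv_whiskerLeft]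
  exact (eHomEquiv V).injective.eq_iff

section EilenbergMoore

variable [HasEqualizers V]

/-- The hom-object of the Eilenberg–Moore category, for algebras `A` and `B` with structure maps
`a` and `b`: the equalizer of `C(A, B) ⟶ C(T A, T B) ⟶ C(T A, B)` (postcomposition with `b`) and
`C(A, B) ⟶ C(T A, B)` (precomposition with `a`). -/
noncomputable def emHom (A B : T.Algebra) : V :=
  equalizer (ET.endo.ehom A.A B.A ≫ eHomWhiskerLeft V (T.obj A.A) B.a)
    (eHomWhiskerRight V A.a B.A)

/-- The inclusion of the hom-object of the Eilenberg–Moore category. -/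
noncomputable def emι (A B : T.Algebra) : ET.emHom A B ⟶ (A.A ⟶[V] B.A) :=
  equalizer.ι _ _

instance (A B : T.Algebra) : Mono (ET.emι A B) :=
  inferInstanceAs (Mono (equalizer.ι _ _))

lemma emι_condition (A B : T.Algebra) :
    ET.emι A B ≫ ET.endo.ehom A.A B.A ≫ eHomWhiskerLeft V (T.obj A.A) B.a =
      ET.emι A B ≫ eHomWhiskerRight V A.a B.A :=
  equalizer.condition _ _

/-- The universal property of the hom-object of the Eilenberg–Moore category. -/
noncomputable def emLift {A B : T.Algebra} {W : V} (h : W ⟶ (A.A ⟶[V] B.A))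
    (w : h ≫ ET.endo.ehom A.A B.A ≫ eHomWhiskerLeft V (T.obj A.A) B.a =
      h ≫ eHomWhiskerRight V A.a B.A) : W ⟶ ET.emHom A B :=
  equalizer.lift h w

@[simp]
lemma emLift_emι {A B : T.Algebra} {W : V} (h : W ⟶ (A.A ⟶[V] B.A))
    (w : h ≫ ET.endo.ehom A.A B.A ≫ eHomWhiskerLeft V (T.obj A.A) B.a =
      h ≫ eHomWhiskerRight V A.a B.A) : ET.emLift h w ≫ ET.emι A B = h :=
  equalizer.lift_ι _ _

lemma emComp_condition (A B D : T.Algebra) :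
    ((ET.emι A B ⊗ₘ ET.emι B D) ≫ eComp V A.A B.A D.A) ≫ ET.endo.ehom A.A D.A ≫
        eHomWhiskerLeft V (T.obj A.A) D.a =
      ((ET.emι A B ⊗ₘ ET.emι B D) ≫ eComp V A.A B.A D.A) ≫ eHomWhiskerRight V A.a D.A := by
  have h₁ : eComp V A.A B.A D.A ≫ ET.endo.ehom A.A D.A =
      (ET.endo.ehom A.A B.A ⊗ₘ ET.endo.ehom B.A D.A) ≫
        eComp V (T.obj A.A) (T.obj B.A) (T.obj D.A) := ET.endo.ehom_comp _ _ _
  calc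
    _ = (ET.emι A B ⊗ₘ ET.emι B D) ≫
        (ET.endo.ehom A.A B.A ⊗ₘ ET.endo.ehom B.A D.A) ≫
        (_ ◁ eHomWhiskerLeft V (T.obj B.A) D.a) ≫ eComp V (T.obj A.A) (T.obj B.A) D.A := by
      rw [Category.assoc, reassoc_of% h₁, eComp_eHomWhiskerLeft]
    _ = (ET.emι A B ≫ ET.endo.ehom A.A B.A) ▷ _ ≫
        (_ ◁ (ET.emι B D ≫ ET.endo.ehom B.A D.A ≫ eHomWhiskerLeft V (T.obj B.A) D.a)) ≫
          eComp V (T.obj A.A) (T.obj B.A) D.A := by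
      simp [MonoidalCategory.tensorHom_def, MonoidalCategory.whisker_exchange_assoc]
    _ = (ET.emι A B ≫ ET.endo.ehom A.A B.A) ▷ _ ≫ (_ ◁ ET.emι B D) ≫
          eHomWhiskerLeft V (T.obj A.A) B.a ▷ _ ≫ eComp V (T.obj A.A) B.A D.A := by
      rw [ET.emι_condition, MonoidalCategory.whiskerLeft_comp, Category.assoc, eComp_dinatural]
    _ = (ET.emι A B ≫ ET.endo.ehom A.A B.A ≫ eHomWhiskerLeft V (T.obj A.A) B.a) ▷ _ ≫
          (_ ◁ ET.emι B D) ≫ eComp V (T.obj A.A) B.A D.A := by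
      simp [MonoidalCategory.whisker_exchange_assoc]
    _ = (ET.emι A B ⊗ₘ ET.emι B D) ≫ eHomWhiskerRight V A.a B.A ▷ _ ≫
          eComp V (T.obj A.A) B.A D.A := by
      rw [ET.emι_condition]
      simp [MonoidalCategory.tensorHom_def, MonoidalCategory.whisker_exchange_assoc]
    _ = _ := by rw [Category.assoc, eComp_eHomWhiskerRight]

/-- The `V`-enrichment of the Eilenberg–Moore category. -/
@[reducible]
noncomputable def em : EnrichedOrdinaryCategory V T.Algebra where
  Hom A B := ET.emHom A B
  id A := ET.emLift (eId V A.A) (by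
    rw [← eHomEquiv_id, eHomEquiv_condition_iff]; simp)
  comp A B D := ET.emLift ((ET.emι A B ⊗ₘ ET.emι B D) ≫ eComp V A.A B.A D.A)
    (ET.emComp_condition A B D)
  id_comp A B := by
    rw [← cancel_mono (ET.emι A B)]
    simp only [Category.assoc, emLift_emι, Category.id_comp]
    rw [tensorHom_def_assoc, ← comp_whiskerRight_assoc, emLift_emι,
      ← whisker_exchange_assoc, ← leftUnitor_inv_naturality_assoc, e_id_comp, Category.comp_id]
  comp_id A B := by
    rw [← cancel_mono (ET.emι A B)]
    simp only [Category.assoc, emLift_emι, Category.id_comp]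
    rw [tensorHom_def'_assoc, ← MonoidalCategory.whiskerLeft_comp_assoc, emLift_emι,
      whisker_exchange_assoc, ← rightUnitor_inv_naturality_assoc, e_comp_id, Category.comp_id]
  assoc A B D F := by
    rw [← cancel_mono (ET.emι A F)]
    simp only [Category.assoc, emLift_emι]
    have h₁ : ET.emLift _ (ET.emComp_condition A B D) ▷ ET.emHom D F ≫
        (ET.emι A D ⊗ₘ ET.emι D F) =
        ((ET.emι A B ⊗ₘ ET.emι B D) ⊗ₘ ET.emι D F) ≫ eComp V A.A B.A D.A ▷ _ := by
      rw [MonoidalCategory.tensorHom_def (ET.emι A D), ← comp_whiskerRight_assoc, emLift_emι,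
        MonoidalCategory.tensorHom_def (_ ⊗ₘ _), comp_whiskerRight, Category.assoc,
        Category.assoc, MonoidalCategory.whisker_exchange]
    have h₂ : ET.emHom A B ◁ ET.emLift _ (ET.emComp_condition B D F) ≫
        (ET.emι A B ⊗ₘ ET.emι B F) =
        (ET.emι A B ⊗ₘ (ET.emι B D ⊗ₘ ET.emι D F)) ≫ _ ◁ eComp V B.A D.A F.A := by
      rw [MonoidalCategory.tensorHom_def' (ET.emι A B) (ET.emι B F),
        ← MonoidalCategory.whiskerLeft_comp_assoc, emLift_emι,
        MonoidalCategory.tensorHom_def' (ET.emι A B) (_ ⊗ₘ _),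
        MonoidalCategory.whiskerLeft_comp, Category.assoc, Category.assoc,
        MonoidalCategory.whisker_exchange]
    rw [reassoc_of% h₁, reassoc_of% h₂, ← e_assoc]
    simp
  homEquiv {A B} :=
    { toFun f := ET.emLift (eHomEquiv V f.f) ((ET.eHomEquiv_condition_iff f.f).2 f.h)
      invFun g :=
        { f := (eHomEquiv V).symm (g ≫ ET.emι A B)
          h := by
            rw [← ET.eHomEquiv_condition_iff, Equiv.apply_symm_apply, Category.assoc,
              Category.assoc, emι_condition] }
      left_inv f := by ext; simp
      right_inv g := by rw [← cancel_mono (ET.emι A B)]; simp }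
  homEquiv_id A := by
    rw [← cancel_mono (ET.emι A A)]
    change _ = ET.emLift _ _ ≫ _
    simp
  homEquiv_comp {A B D} f g := by
    rw [← cancel_mono (ET.emι A D)]
    simp only [Equiv.coe_fn_mk, emLift_emι, Category.assoc, Monad.Algebra.comp_f]
    change _ = _ ≫ _ ≫ ET.emLift _ _ ≫ _
    rw [emLift_emι, tensorHom_comp_tensorHom_assoc, emLift_emι, emLift_emι, eHomEquiv_comp]

end EilenbergMoore

/-! #### Kleisli categories -/

lemma mult_condition {X Y : C} :
    ET.endo.ehom X Y ≫ eHomWhiskerRight V (muApp T X) (T.obj Y) =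
      ET.endo.ehom X Y ≫ ET.endo.ehom (T.obj X) (T.obj Y) ≫
        eHomWhiskerLeft V (T.obj (T.obj X)) (muApp T Y) :=
  (ET.mult X Y).trans (Category.assoc _ _ _)

lemma unit_condition {X Y : C} :
    ET.endo.ehom X Y ≫ eHomWhiskerRight V (T.η.app X) (T.obj Y) =
      eHomWhiskerLeft V X (T.η.app Y) :=
  (ET.unit X Y).trans (Category.id_comp _)

/-- Composition in the Kleisli category with hom-objects `C(X, T Y)`. -/
def klComp (X Y Z : C) :
    ((X ⟶[V] T.obj Y) ⊗ (Y ⟶[V] T.obj Z)) ⟶ (X ⟶[V] T.obj Z) :=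
  (X ⟶[V] T.obj Y) ◁ ET.endo.ehom Y (T.obj Z) ≫ eComp V X (T.obj Y) (T.obj (T.obj Z)) ≫
    eHomWhiskerLeft V X (muApp T Z)

lemma klComp_ehom (X Y Z : C) :
    ET.klComp X Y Z ≫ ET.endo.ehom X (T.obj Z) =
      (ET.endo.ehom X (T.obj Y) ▷ _ ≫ _ ◁ (ET.endo.ehom Y (T.obj Z) ≫
        ET.endo.ehom (T.obj Y) (T.obj (T.obj Z))) ≫
        eComp V (T.obj X) (T.obj (T.obj Y)) (T.obj (T.obj (T.obj Z)))) ≫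
        eHomWhiskerLeft V (T.obj X) (T.map (muApp T Z)) := by
  have := ET.endo.ehom_comp X (T.obj Y) (T.obj (T.obj Z))
  have e₂ := ET.endo.whiskerLeft_ehom X (muApp T Z)
  simp only [klComp, Category.assoc]
  erw [e₂, reassoc_of% this]
  rw [MonoidalCategory.tensorHom_def_assoc, MonoidalCategory.whisker_exchange_assoc]
  simp only [MonoidalCategory.whiskerLeft_comp, Category.assoc]

lemma ehom_ehom_mult (X Y Z : C) :
    (_ ◁ (ET.endo.ehom Y (T.obj Z) ≫ ET.endo.ehom (T.obj Y) (T.obj (T.obj Z))) ≫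
        eComp V (T.obj X) (T.obj (T.obj Y)) (T.obj (T.obj (T.obj Z)))) ≫
        eHomWhiskerLeft V (T.obj X) (muApp T (T.obj Z)) =
      _ ◁ (ET.endo.ehom Y (T.obj Z) ≫ eHomWhiskerRight V (muApp T Y) (T.obj (T.obj Z))) ≫
        eComp V (T.obj X) (T.obj (T.obj Y)) (T.obj (T.obj Z)) := by
  rw [Category.assoc, eComp_eHomWhiskerLeft, mult_condition]
  simp only [MonoidalCategory.whiskerLeft_comp, Category.assoc]

lemma klComp_assoc (W X Y Z : C) :
    (α_ _ _ _).inv ≫ ET.klComp W X Y ▷ _ ≫ ET.klComp W Y Z =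
      _ ◁ ET.klComp X Y Z ≫ ET.klComp W X Z := by
  have hμ : eHomWhiskerLeft V W (T.map (muApp T Z)) ≫ eHomWhiskerLeft V W (muApp T Z) =
      eHomWhiskerLeft V W (muApp T (T.obj Z)) ≫ eHomWhiskerLeft V W (muApp T Z) := by
    rw [← eHomWhiskerLeft_comp, ← eHomWhiskerLeft_comp, map_muApp]
  have e₁ := ET.klComp_ehom X Y Z
  have e₂ := ET.ehom_ehom_mult X Y Z
  calc
    _ = (α_ _ _ _).inv ≫ ((W ⟶[V] T.obj X) ◁ ET.endo.ehom X (T.obj Y)) ▷ _ ≫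
        eComp V W (T.obj X) (T.obj (T.obj Y)) ▷ _ ≫
        _ ◁ (ET.endo.ehom Y (T.obj Z) ≫ eHomWhiskerRight V (muApp T Y) (T.obj (T.obj Z))) ≫
        eComp V W (T.obj (T.obj Y)) (T.obj (T.obj Z)) ≫ eHomWhiskerLeft V W (muApp T Z) := by
      rw [MonoidalCategory.whiskerLeft_comp, Category.assoc]
      have := eComp_dinatural (V := V) W (muApp T Y) (T.obj (T.obj Z))
      erw [reassoc_of% this]
      rw [MonoidalCategory.whisker_exchange_assoc]
      simp only [klComp, comp_whiskerRight, Category.assoc]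
    _ = _ ◁ (ET.endo.ehom X (T.obj Y) ▷ _ ≫ _ ◁ (ET.endo.ehom Y (T.obj Z) ≫
        eHomWhiskerRight V (muApp T Y) (T.obj (T.obj Z))) ≫
        eComp V (T.obj X) (T.obj (T.obj Y)) (T.obj (T.obj Z))) ≫
        eComp V W (T.obj X) (T.obj (T.obj Z)) ≫ eHomWhiskerLeft V W (muApp T Z) := by
      rw [← MonoidalCategory.whisker_exchange_assoc]
      simp only [MonoidalCategory.whiskerLeft_comp, Category.assoc, ← e_assoc_assoc]
      simp
    _ = _ ◁ (ET.klComp X Y Z ≫ ET.endo.ehom X (T.obj Z)) ≫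
        eComp V W (T.obj X) (T.obj (T.obj Z)) ≫ eHomWhiskerLeft V W (muApp T Z) := by
      rw [e₁, MonoidalCategory.whiskerLeft_comp _ (_ ≫ _ ≫ _), Category.assoc]
      have := eComp_eHomWhiskerLeft V W (T.obj X) (T.map (muApp T Z))
      rw [← reassoc_of% this, hμ]
      rw [← e₂, eComp_eHomWhiskerLeft_assoc]
      simp only [MonoidalCategory.whiskerLeft_comp, Category.assoc]
    _ = _ := by simp [klComp]

/-- The `V`-enrichment of the Kleisli category with hom-objects `C(X, T Y)`. -/
@[reducible]
def naiveKleisli : EnrichedOrdinaryCategory V (Kleisli T) where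
  Hom X Y := X.of ⟶[V] T.obj Y.of
  id X := eHomEquiv V (T.η.app X.of)
  comp X Y Z := ET.klComp X.of Y.of Z.of
  id_comp X Y := by
    have h : (λ_ _).inv ≫ eHomEquiv V (T.η.app X.of) ▷ _ ≫ eComp V X.of (T.obj X.of) _ =
      eHomWhiskerRight V (T.η.app X.of) (T.obj (T.obj Y.of)) := rfl
    rw [klComp, ← MonoidalCategory.whisker_exchange_assoc, ← leftUnitor_inv_naturality_assoc]
    erw [reassoc_of% h, ← Category.assoc, unit_condition]
    rw [← eHomWhiskerLeft_comp, unit_muApp]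
    exact eHomWhiskerLeft_id V _ _
  comp_id X Y := by
    have h : (ρ_ _).inv ≫ (X.of ⟶[V] T.obj Y.of) ◁ eHomEquiv V (T.map (T.η.app Y.of)) ≫
      eComp V X.of (T.obj Y.of) _ = eHomWhiskerLeft V X.of (T.map (T.η.app Y.of)) := rfl
    have h' := ET.endo.homEquiv_map (T.η.app Y.of)
    rw [klComp, ← MonoidalCategory.whiskerLeft_comp_assoc]
    erw [← h', reassoc_of% h]
    rw [← eHomWhiskerLeft_comp, map_unit_muApp]
    exact eHomWhiskerLeft_id V _ _
  assoc W X Y Z := ET.klComp_assoc _ _ _ _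
  homEquiv {X Y} :=
    { toFun f := eHomEquiv V f.of
      invFun g := ⟨(eHomEquiv V).symm g⟩
      left_inv f := by ext; simp
      right_inv g := by simp }
  homEquiv_id X := rfl
  homEquiv_comp {X Y Z} f g := by
    change eHomEquiv V (f.of ≫ T.map g.of ≫ muApp T Z.of) =
      (λ_ _).inv ≫ (eHomEquiv V f.of ⊗ₘ eHomEquiv V g.of) ≫ ET.klComp _ _ _
    rw [klComp, MonoidalCategory.tensorHom_def_assoc, ← MonoidalCategory.whiskerLeft_comp_assoc]
    have h' := ET.endo.homEquiv_map g.of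
    erw [← h', ← MonoidalCategory.tensorHom_def_assoc, ← eHomEquiv_comp_assoc]
    rw [eHomEquiv_whiskerLeft]
    simp

lemma comparison_condition (X Y : C) :
    (ET.endo.ehom X (T.obj Y) ≫ eHomWhiskerLeft V (T.obj X) (muApp T Y)) ≫
        ET.endo.ehom (T.obj X) (T.obj Y) ≫ eHomWhiskerLeft V (T.obj (T.obj X)) (muApp T Y) =
      (ET.endo.ehom X (T.obj Y) ≫ eHomWhiskerLeft V (T.obj X) (muApp T Y)) ≫
        eHomWhiskerRight V (muApp T X) (T.obj Y) := by
  have h := ET.endo.whiskerLeft_ehom (T.obj X) (muApp T Y)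
  have h' := eHom_whisker_exchange V (muApp T X) (muApp T Y)
  have h'' := ET.mult_condition (X := X) (Y := T.obj Y)
  rw [Category.assoc, Category.assoc]
  erw [reassoc_of% h, h', reassoc_of% h'']
  rw [← eHomWhiskerLeft_comp, ← eHomWhiskerLeft_comp, map_muApp]

lemma comparison_id (X : C) :
    eHomEquiv V (T.η.app X) ≫ ET.endo.ehom X (T.obj X) ≫
      eHomWhiskerLeft V (T.obj X) (muApp T X) = eId V (T.obj X) := by
  have h := ET.endo.homEquiv_map (T.η.app X)
  erw [← reassoc_of% h]
  rw [eHomEquiv_whiskerLeft, map_unit_muApp, eHomEquiv_id]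

lemma comparison_comp (X Y Z : C) :
    ET.klComp X Y Z ≫ ET.endo.ehom X (T.obj Z) ≫ eHomWhiskerLeft V (T.obj X) (muApp T Z) =
      ((ET.endo.ehom X (T.obj Y) ≫ eHomWhiskerLeft V (T.obj X) (muApp T Y)) ⊗ₘ
        (ET.endo.ehom Y (T.obj Z) ≫ eHomWhiskerLeft V (T.obj Y) (muApp T Z))) ≫
        eComp V (T.obj X) (T.obj Y) (T.obj Z) := by
  have hμ : eHomWhiskerLeft V (T.obj X) (T.map (muApp T Z)) ≫
      eHomWhiskerLeft V (T.obj X) (muApp T Z) =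
      eHomWhiskerLeft V (T.obj X) (muApp T (T.obj Z)) ≫
        eHomWhiskerLeft V (T.obj X) (muApp T Z) := by
    rw [← eHomWhiskerLeft_comp, ← eHomWhiskerLeft_comp, map_muApp]
  have e₁ := ET.klComp_ehom X Y Z
  have e₂ := ET.ehom_ehom_mult X Y Z
  simp only [Category.assoc] at e₁ e₂
  rw [reassoc_of% e₁, hμ, reassoc_of% e₂, MonoidalCategory.whiskerLeft_comp, Category.assoc,
    reassoc_of% (eComp_dinatural (V := V) (T.obj X) (muApp T Y) (T.obj (T.obj Z))),
    eComp_eHomWhiskerLeft, MonoidalCategory.tensorHom_def]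
  simp only [MonoidalCategory.whiskerLeft_comp, comp_whiskerRight, Category.assoc,
    ← MonoidalCategory.whisker_exchange_assoc]

lemma comparison_map {X Y : C} (f : X ⟶ T.obj Y) :
    eHomEquiv V (T.map f ≫ muApp T Y) = eHomEquiv V f ≫ ET.endo.ehom X (T.obj Y) ≫
      eHomWhiskerLeft V (T.obj X) (muApp T Y) := by
  have h := ET.endo.homEquiv_map f
  erw [← reassoc_of% h]
  rw [eHomEquiv_whiskerLeft]

section

variable [HasEqualizers V]

/-- The enrichment of the free algebra functor, sending `X` to the free algebra on `X`. -/
noncomputable def free : letI := ET.em; FunctorEnrichment V T.free :=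
  letI := ET.em
  { ehom X Y := ET.emLift (A := T.free.obj X) (B := T.free.obj Y) (ET.endo.ehom X Y)
      ET.mult_condition.symm
    ehom_id X := by
      rw [← cancel_mono (ET.emι _ _)]
      change _ = ET.emLift _ _ ≫ _
      erw [Category.assoc, emLift_emι, emLift_emι]
      exact ET.endo.ehom_id X
    ehom_comp X Y Z := by
      rw [← cancel_mono (ET.emι _ _)]
      change _ = (_ ≫ ET.emLift _ _) ≫ _
      erw [Category.assoc, emLift_emι, Category.assoc, emLift_emι,
        tensorHom_comp_tensorHom_assoc, emLift_emι, emLift_emι]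
      exact ET.endo.ehom_comp X Y Z
    homEquiv_map {X Y} f := by
      rw [← cancel_mono (ET.emι _ _)]
      change ET.emLift _ _ ≫ _ = _
      erw [Category.assoc, emLift_emι, emLift_emι]
      exact ET.endo.homEquiv_map f }

end

end MonadEnrichment

section

variable (T : Monad C)

/-- The transformation from `T ⋙ T.free` to `T.free` with components the multiplication
`T (T X) ⟶ T X`. -/
def freeMult : T.toFunctor ⋙ T.free ⟶ T.free where
  app X := { f := T.μ.app X, h := T.assoc X }
  naturality X Y f := by ext; exact T.μ.naturality f

/-- The functor from the Kleisli category to the Eilenberg–Moore category sending `X` to the free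
algebra on `X` and `f : X ⟶ T Y` to `T f ≫ μ Y`. -/
@[simps]
def comparisonFunctor : Kleisli T ⥤ T.Algebra where
  obj X := T.free.obj X.of
  map {X Y} f :=
    { f := T.map f.of ≫ muApp T Y.of
      h := by
        change T.map (T.map f.of ≫ muApp T Y.of) ≫ muApp T Y.of =
          muApp T X.of ≫ T.map f.of ≫ muApp T Y.of
        rw [T.map_comp, Category.assoc, map_muApp, ← Category.assoc, muApp_naturality,
          Category.assoc] }
  map_id X := by ext; exact T.right_unit X.of
  map_comp {X Y Z} f g := by
    ext
    change T.map (f.of ≫ T.map g.of ≫ muApp T Z.of) ≫ muApp T Z.of =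
      (T.map f.of ≫ muApp T Y.of) ≫ T.map g.of ≫ muApp T Z.of
    have := muApp_naturality T g.of
    rw [T.map_comp, T.map_comp, Category.assoc, Category.assoc, Category.assoc, map_muApp,
      reassoc_of% this]

end

namespace MonadEnrichment

variable {T : Monad C} (ET : MonadEnrichment V T) [HasEqualizers V]

/-- The enrichment of `comparisonFunctor`, given by
`C(X, T Y) ⟶ C(T X, T (T Y)) ⟶ C(T X, T Y)`. -/
noncomputable def comparison :
    letI := ET.em; letI := ET.naiveKleisli; FunctorEnrichment V (comparisonFunctor T) :=
  letI := ET.em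
  letI := ET.naiveKleisli
  { ehom X Y := ET.emLift (A := T.free.obj X.of) (B := T.free.obj Y.of)
      (ET.endo.ehom X.of (T.obj Y.of) ≫ eHomWhiskerLeft V (T.obj X.of) (muApp T Y.of))
      (ET.comparison_condition X.of Y.of)
    ehom_id X := by
      rw [← cancel_mono (ET.emι _ _)]
      refine (Category.assoc _ _ _).trans ((_ ≫= ET.emLift_emι _ _).trans
        (Eq.trans ?_ (ET.emLift_emι _ _).symm))
      exact ET.comparison_id X.of
    ehom_comp X Y Z := by
      rw [← cancel_mono (ET.emι _ _)]
      refine (Category.assoc _ _ _).trans ((_ ≫= ET.emLift_emι _ _).trans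
        (Eq.trans ?_ ((_ ≫= ET.emLift_emι _ _).symm.trans (Category.assoc _ _ _).symm)))
      erw [tensorHom_comp_tensorHom_assoc, emLift_emι, emLift_emι]
      exact ET.comparison_comp X.of Y.of Z.of
    homEquiv_map {X Y} f := by
      rw [← cancel_mono (ET.emι _ _)]
      refine (ET.emLift_emι _ _).trans (Eq.trans ?_
        ((_ ≫= ET.emLift_emι _ _).symm.trans (Category.assoc _ _ _).symm))
      exact ET.comparison_map f.of }

lemma em_whiskerLeft (A : T.Algebra) {B D : T.Algebra} (g : B ⟶ D) :
    letI := ET.em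
    eHomWhiskerLeft V A g ≫ ET.emι A D = ET.emι A B ≫ eHomWhiskerLeft V A.A g.f := by
  let := ET.em
  have h : eHomEquiv V g ≫ ET.emι B D = eHomEquiv V g.f := ET.emLift_emι _ _
  have h' : eComp V A B D ≫ ET.emι A D = (ET.emι A B ⊗ₘ ET.emι B D) ≫ eComp V A.A B.A D.A :=
    ET.emLift_emι _ _
  rw [eHomWhiskerLeft, Category.assoc, Category.assoc, h', eHomWhiskerLeft, ← h]
  exact rightUnitor_inv_tensor _ _ _ _

lemma em_whiskerRight {A B : T.Algebra} (f : A ⟶ B) (D : T.Algebra) :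
    letI := ET.em
    eHomWhiskerRight V f D ≫ ET.emι A D = ET.emι B D ≫ eHomWhiskerRight V f.f D.A := by
  let := ET.em
  have h : eHomEquiv V f ≫ ET.emι A B = eHomEquiv V f.f := ET.emLift_emι _ _
  have h' : eComp V A B D ≫ ET.emι A D = (ET.emι A B ⊗ₘ ET.emι B D) ≫ eComp V A.A B.A D.A :=
    ET.emLift_emι _ _
  rw [eHomWhiskerRight, Category.assoc, Category.assoc, h', eHomWhiskerRight, ← h]
  exact leftUnitor_inv_tensor _ _ _ _

/-- The transformation between free algebras with components the multiplication `T (T X) ⟶ T X`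
is enriched. -/
lemma isEnriched_freeMult :
    letI := ET.em
    IsEnriched (ET.endo.comp ET.free) ET.free (freeMult T) := by
  let := ET.em
  intro X Y
  rw [← cancel_mono (ET.emι _ _), Category.assoc, Category.assoc]
  have h₁ := ET.em_whiskerRight ((freeMult T).app X) (T.free.obj Y)
  have h₂ := ET.em_whiskerLeft (T.free.obj (T.obj X)) ((freeMult T).app Y)
  refine (_ ≫= h₁).trans (Eq.trans ?_ (_ ≫= h₂).symm)
  rw [← Category.assoc, ← Category.assoc]
  have h₃ : ET.free.ehom X Y ≫ ET.emι _ _ = ET.endo.ehom X Y := ET.emLift_emι _ _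
  have h₄ : (ET.endo.comp ET.free).ehom X Y ≫ ET.emι _ _ =
      ET.endo.ehom X Y ≫ ET.endo.ehom (T.obj X) (T.obj Y) :=
    (Category.assoc _ _ _).trans (_ ≫= ET.emLift_emι _ _)
  refine (h₃ =≫ _).trans (Eq.trans ?_ (h₄ =≫ _).symm)
  exact ET.mult X Y

end MonadEnrichment

/-- An enriched functor that lands in a full subcategory is enriched as a functor to that full
subcategory. -/
def FunctorEnrichment.lift {D : Type u₂} [Category.{v₂} D] [EnrichedOrdinaryCategory V D]
    {F : C ⥤ D} (EF : FunctorEnrichment V F) (P : ObjectProperty D) (hF : ∀ X, P (F.obj X)) :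
    FunctorEnrichment V (P.lift F hF) where
  ehom X Y := EF.ehom X Y
  ehom_id X := EF.ehom_id X
  ehom_comp X Y Z := EF.ehom_comp X Y Z
  homEquiv_map f := EF.homEquiv_map f

end EnrichedMonads
/-! ### Kleisli objects in the bicategory of enriched categories -/

section KleisliObjects

open MonoidalCategory Limits

variable {V : Type u'} [Category.{v'} V] [MonoidalCategory V]

/-- The monad on the underlying category given by a monad in `EnrichCat V`. -/
def BicatMonad.toMonad (m : BicatMonad (EnrichCat.{v, u} V)) : Monad m.ob.carrier where
  toFunctor := m.endo.functor
  η := m.unit.nat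
  μ := m.mult.nat
  assoc X := by
    have h : m.mult.nat.app (m.endo.functor.obj X) ≫ m.mult.nat.app X =
        𝟙 _ ≫ m.endo.functor.map (m.mult.nat.app X) ≫ m.mult.nat.app X :=
      congrArg (fun τ => τ.nat.app X) m.mult_assoc
    rw [Category.id_comp] at h
    exact h.symm
  left_unit X := by
    have h : 𝟙 _ ≫ m.unit.nat.app (m.endo.functor.obj X) ≫ m.mult.nat.app X = 𝟙 _ :=
      congrArg (fun τ => τ.nat.app X) m.mult_unit_left
    rwa [Category.id_comp] at h
  right_unit X := by
    have h : 𝟙 _ ≫ m.endo.functor.map (m.unit.nat.app X) ≫ m.mult.nat.app X = 𝟙 _ :=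
      congrArg (fun τ => τ.nat.app X) m.mult_unit_right
    rwa [Category.id_comp] at h

/-- A monad in `EnrichCat V` is enriched. -/
def BicatMonad.enrichment (m : BicatMonad (EnrichCat.{v, u} V)) :
    MonadEnrichment V m.toMonad where
  endo := m.endo.enrichment
  unit := m.unit.isEnriched
  mult := m.mult.isEnriched

/-- The Kleisli category of an enriched monad `T` whose objects are those of the base category and
whose hom-objects are `C(X, T Y)`. -/
def naiveKleisli (m : BicatMonad (EnrichCat.{v, u} V)) : EnrichCat.{v, u} V :=
  letI := m.enrichment.naiveKleisli
  { carrier := Kleisli m.toMonad }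

/-- An enriched functor is a weak equivalence if it is fully faithful, in the sense that its
actions on hom-objects are isomorphisms, and essentially surjective. -/
structure EnrichFunctor.IsWeakEquivalence {C : EnrichCat.{v₁, u₁} V} {D : EnrichCat.{v₂, u₂} V}
    (F : EnrichFunctor C D) : Prop where
  isIso_ehom (X Y : C.carrier) : IsIso (F.enrichment.ehom X Y)
  essSurj : F.functor.EssSurj

/-- An enriched category is univalent if, in its underlying category, equality of objects is the
same as isomorphism. -/
def EnrichCat.IsUnivalent (C : EnrichCat.{v, u} V) : Prop :=
  ∀ X Y : C.carrier, Function.Bijective (fun h : X = Y => eqToIso h)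

variable (V) in
/-- The bicategory of univalent enriched categories: the full sub-bicategory of `EnrichCat V` on
the univalent enriched categories. -/
abbrev UnivEnrichCat :=
  Bicategory.InducedBicategory (EnrichCat.{v, u} V)
    (fun C : {C : EnrichCat.{v, u} V // C.IsUnivalent} => C.1)

variable [HasEqualizers V]

/-- The Kleisli category of an enriched monad, as the enriched full subcategory of the
Eilenberg–Moore category on the algebras that are isomorphic to a free algebra. -/
noncomputable def kleisli (m : BicatMonad (EnrichCat.{v, max u v} V)) :
    EnrichCat.{v, max u v} V :=
  letI := m.enrichment.em
  { carrier := m.toMonad.free.essImage.FullSubcategory }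

/-- The enriched functor to the Kleisli category sending `X` to the free algebra on `X`. -/
noncomputable def kleisliLeg (m : BicatMonad (EnrichCat.{v, max u v} V)) :
    m.ob ⟶ kleisli.{v, u} m :=
  letI := m.enrichment.em
  { functor := m.toMonad.free.essImage.lift m.toMonad.free
      (m.toMonad.free.obj_mem_essImage)
    enrichment := m.enrichment.free.lift _ _ }

/-- The Kleisli cocone on the Kleisli category: the free algebra functor together with the
transformation whose components are the algebra morphisms `T (T X) ⟶ T X`. -/
noncomputable def kleisliCocone (m : BicatMonad (EnrichCat.{v, max u v} V)) :
    KleisliCocone m where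
  ob := kleisli.{v, u} m
  leg := kleisliLeg.{v, u} m
  cell :=
    letI := m.enrichment.em
    { nat :=
        { app X := ObjectProperty.homMk ((freeMult m.toMonad).app X)
          naturality X Y f :=
            ObjectProperty.hom_ext _ ((freeMult m.toMonad).naturality f) }
      isEnriched := m.enrichment.isEnriched_freeMult }
  unit_cell := by
    refine EnrichTrans.hom_ext fun X => ObjectProperty.hom_ext _ ?_
    ext
    exact m.toMonad.right_unit X
  mult_cell := by
    refine EnrichTrans.hom_ext fun X => ObjectProperty.hom_ext _ ?_
    ext
    refine Eq.trans ?_ (Category.id_comp _).symm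
    exact m.toMonad.assoc X

/-- The enriched functor from the naive Kleisli category to the Kleisli category that sends `X` to
the free algebra on `X` and acts on hom-objects by `C(X, T Y) ⟶ C(T X, T (T Y)) ⟶ C(T X, T Y)`. -/
noncomputable def kleisliComparison (m : BicatMonad (EnrichCat.{v, max u v} V)) :
    EnrichFunctor (naiveKleisli.{v, max u v} m) (kleisli.{v, u} m) :=
  letI := m.enrichment.em
  letI := m.enrichment.naiveKleisli
  { functor := m.toMonad.free.essImage.lift (comparisonFunctor m.toMonad)
      (fun X => m.toMonad.free.obj_mem_essImage X.of)
    enrichment := m.enrichment.comparison.lift _ _ }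

end KleisliObjects

end EnrichedKleisli

open CategoryTheory.Limits EnrichedKleisli

/-!
The argument rests on a criterion, `KleisliCocone.isUniversal_of_isIso_descHom`: a Kleisli cocone
with leg `ℓ : C ⟶ K` and cell `λ` is universal as soon as `ℓ` is essentially surjective and the maps
`C(X, T Y) ⟶ K(ℓ X, ℓ (T Y)) ⟶ K(ℓ X, ℓ Y)`, given by `ℓ` and postcomposition with `λ Y`, are
invertible. These maps exist for every Kleisli cocone (`KleisliCocone.descHom`) and turn Kleisli
composition into composition.

For the one-dimensional part, a second cocone `q` with leg `ℓ'` has maps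
`C(X, T Y) ⟶ Q(ℓ' X, ℓ' Y)` of the same kind. Composed with the inverses of those of `k`, they form a
`V`-functor from the full image of `ℓ` to `Q` (`KleisliCocone.descImage`). Choosing for each object
`A` of `K` an object `s A` and an isomorphism `ℓ (s A) ≅ A` extends it to all of `K`
(`ImageFunctor.extend`), and its values on these isomorphisms form the required invertible 2-cell.

For the two-dimensional part, compatibility with `λ` makes a 2-cell out of the leg
`V`-natural with respect to all of `K(ℓ X, ℓ Y)`, not only the part coming from `C(X, Y)`
(`KleisliCocone.ehom_naturality_of_isIso_descHom`). Enriched naturality is invariant under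
isomorphism of the arguments (`ehom_naturality_of_iso`), so the 2-cell extends uniquely along the
essentially surjective leg.

For the Kleisli category of free algebras, the maps in the criterion are those of the comparison
functor. They are invertible because precomposition with the unit `X ⟶ T X` inverts them on the
equalizer that defines algebra morphisms (`MonadEnrichment.isIso_comparison_ehom`). Univalence is
inherited by algebras and by full subcategories, and a full sub-bicategory reflects universality of
cocones whose vertex lies in it.
-/

namespace EnrichedKleisli

/-! ### Enriched functors on full images -/

section ImageFunctors

open MonoidalCategory

variable {V : Type u'} [Category.{v'} V] [MonoidalCategory V]
  {C : Type u₁} [Category.{v₁} C] [EnrichedOrdinaryCategory V C]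
  {D : Type u₂} [Category.{v₂} D] [EnrichedOrdinaryCategory V D]
  {ι : Type w}

variable (V) in
/-- A `V`-functor to `D` defined on the full enriched image of a family of objects `a : ι → C`: the
index set `ι` serves as the set of objects, and the hom-object from `i` to `j` is
`C(a i, a j)`. Only the enriched data are recorded; the action on morphisms is derived from them
in `ImageFunctor.map`. -/
structure ImageFunctor (a : ι → C) (b : ι → D) where
  ehom (i j : ι) : (a i ⟶[V] a j) ⟶ (b i ⟶[V] b j)
  ehom_id (i : ι) : eId V (a i) ≫ ehom i i = eId V (b i)
  ehom_comp (i j k : ι) :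
    eComp V (a i) (a j) (a k) ≫ ehom i k = (ehom i j ⊗ₘ ehom j k) ≫ eComp V (b i) (b j) (b k)

namespace ImageFunctor

variable {a : ι → C} {b : ι → D} (P : ImageFunctor V a b)

/-- The action on morphisms of a `V`-functor on a full image. -/
def map {i j : ι} (f : a i ⟶ a j) : b i ⟶ b j :=
  (eHomEquiv V).symm (eHomEquiv V f ≫ P.ehom i j)

lemma eHomEquiv_map {i j : ι} (f : a i ⟶ a j) :
    eHomEquiv V (P.map f) = eHomEquiv V f ≫ P.ehom i j :=
  Equiv.apply_symm_apply _ _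

lemma map_id (i : ι) : P.map (𝟙 (a i)) = 𝟙 (b i) := by
  apply (eHomEquiv V).injective
  rw [eHomEquiv_map, eHomEquiv_id, eHomEquiv_id, P.ehom_id]

lemma map_comp {i j k : ι} (f : a i ⟶ a j) (g : a j ⟶ a k) :
    P.map (f ≫ g) = P.map f ≫ P.map g := by
  apply (eHomEquiv V).injective
  rw [eHomEquiv_map, eHomEquiv_comp, eHomEquiv_comp, eHomEquiv_map, eHomEquiv_map,
    Category.assoc, Category.assoc, P.ehom_comp, tensorHom_comp_tensorHom_assoc]

/-- The action on isomorphisms of a `V`-functor on a full image. -/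
def mapIso {i j : ι} (e : a i ≅ a j) : b i ≅ b j where
  hom := P.map e.hom
  inv := P.map e.inv
  hom_inv_id := by rw [← map_comp, e.hom_inv_id, map_id]
  inv_hom_id := by rw [← map_comp, e.inv_hom_id, map_id]

lemma whiskerLeft_ehom (i : ι) {j k : ι} (f : a j ⟶ a k) :
    eHomWhiskerLeft V (a i) f ≫ P.ehom i k = P.ehom i j ≫ eHomWhiskerLeft V (b i) (P.map f) := by
  rw [eHomWhiskerLeft, Category.assoc, Category.assoc, P.ehom_comp, eHomWhiskerLeft, eHomEquiv_map]
  exact rightUnitor_inv_tensor _ _ _ _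

lemma whiskerRight_ehom {i j : ι} (f : a i ⟶ a j) (k : ι) :
    eHomWhiskerRight V f (a k) ≫ P.ehom i k =
      P.ehom j k ≫ eHomWhiskerRight V (P.map f) (b k) := by
  rw [eHomWhiskerRight, Category.assoc, Category.assoc, P.ehom_comp, eHomWhiskerRight,
    eHomEquiv_map]
  exact leftUnitor_inv_tensor _ _ _ _

/-- The functor given by a `V`-functor on the full image of the family of all objects. -/
def toFunctor {b : C → D} (P : ImageFunctor V (fun A : C => A) b) : C ⥤ D where
  obj := b
  map f := P.map f
  map_id := P.map_id
  map_comp := P.map_comp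

/-- The enrichment of `ImageFunctor.toFunctor`. -/
def enrichment {b : C → D} (P : ImageFunctor V (fun A : C => A) b) :
    FunctorEnrichment V P.toFunctor where
  ehom := P.ehom
  ehom_id := P.ehom_id
  ehom_comp := P.ehom_comp
  homEquiv_map f := P.eHomEquiv_map f

/-- If every object `A` of `C` is isomorphic to some `a (s A)`, then a `V`-functor on the full image
of `a` extends to all of `C`, by transporting hom-objects along the chosen isomorphisms. -/
@[simps]
def extend (s : C → ι) (e : ∀ A, a (s A) ≅ A) :
    ImageFunctor V (fun A : C => A) (fun A => b (s A)) where
  ehom A B := eHomWhiskerRight V (e A).hom B ≫ eHomWhiskerLeft V (a (s A)) (e B).inv ≫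
    P.ehom (s A) (s B)
  ehom_id A := by
    rw [← eHomEquiv_id, ← Category.assoc, ← Category.assoc, eHomEquiv_whiskerRight,
      eHomEquiv_whiskerLeft, Category.comp_id, (e A).hom_inv_id, eHomEquiv_id, P.ehom_id]
  ehom_comp A B D := by
    rw [eComp_eHomWhiskerRight_assoc, eComp_eHomWhiskerLeft_assoc,
      ← eHom_whisker_cancel_assoc V (e B).symm, P.ehom_comp,
      ← eHom_whisker_exchange_assoc (V := V) (e B).hom (e D).inv]
    simp only [MonoidalCategory.tensorHom_def, MonoidalCategory.whiskerLeft_comp, comp_whiskerRight,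
      Category.assoc, Iso.symm_hom, Iso.symm_inv, MonoidalCategory.whisker_exchange_assoc]

lemma extend_map (s : C → ι) (e : ∀ A, a (s A) ≅ A) {A B : C} (f : A ⟶ B) :
    (P.extend s e).map f = P.map ((e A).hom ≫ f ≫ (e B).inv) := by
  apply (eHomEquiv V).injective
  refine ((P.extend s e).eHomEquiv_map f).trans ?_
  rw [eHomEquiv_map, ← eHomEquiv_whiskerRight, ← eHomEquiv_whiskerLeft, Category.assoc,
    Category.assoc, eHom_whisker_exchange_assoc, extend_ehom]

end ImageFunctor

end ImageFunctors

/-! ### Enriched naturality -/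

section Transformations

open MonoidalCategory

variable {V : Type u'} [Category.{v'} V] [MonoidalCategory V]
  {C : Type u₁} [Category.{v₁} C] [EnrichedOrdinaryCategory V C]
  {D : Type u₂} [Category.{v₂} D] [EnrichedOrdinaryCategory V D]
  {F G : C ⥤ D} (EF : FunctorEnrichment V F) (EG : FunctorEnrichment V G)

/-- For a family of components, the `V`-naturality condition on hom-objects implies naturality on
underlying categories. -/
lemma naturality_of_ehom {X Y : C} (σ : F.obj X ⟶ G.obj X) (τ : F.obj Y ⟶ G.obj Y)
    (h : EG.ehom X Y ≫ eHomWhiskerRight V σ (G.obj Y) =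
      EF.ehom X Y ≫ eHomWhiskerLeft V (F.obj X) τ) (f : X ⟶ Y) :
    F.map f ≫ τ = σ ≫ G.map f := by
  apply (eHomEquiv V).injective
  rw [← eHomEquiv_whiskerLeft, ← eHomEquiv_whiskerRight, EF.homEquiv_map, EG.homEquiv_map,
    Category.assoc, Category.assoc, h]

/-- The `V`-naturality condition on a hom-object is invariant under isomorphisms of both of its
arguments. -/
lemma ehom_naturality_of_iso {X X' Y Y' : C} (e : X' ≅ X) (e' : Y' ≅ Y)
    {σ : F.obj X ⟶ G.obj X} {σ' : F.obj X' ⟶ G.obj X'} {τ : F.obj Y ⟶ G.obj Y}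
    {τ' : F.obj Y' ⟶ G.obj Y'} (hσ : F.map e.hom ≫ σ = σ' ≫ G.map e.hom)
    (hτ : F.map e'.hom ≫ τ = τ' ≫ G.map e'.hom)
    (h : EG.ehom X' Y' ≫ eHomWhiskerRight V σ' (G.obj Y') =
      EF.ehom X' Y' ≫ eHomWhiskerLeft V (F.obj X') τ') :
    EG.ehom X Y ≫ eHomWhiskerRight V σ (G.obj Y) =
      EF.ehom X Y ≫ eHomWhiskerLeft V (F.obj X) τ := by
  have hσ' : σ ≫ G.map e.inv = F.map e.inv ≫ σ' := by
    rw [← cancel_epi (F.map e.hom), reassoc_of% hσ, ← G.map_comp, ← F.map_comp_assoc]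
    simp
  have hR : IsSplitEpi (eHomWhiskerRight V e.inv Y') :=
    ⟨⟨eHomWhiskerRight V e.hom Y', by rw [← eHomWhiskerRight_comp]; simp⟩⟩
  have hL : IsSplitEpi (eHomWhiskerLeft V X e'.hom) :=
    ⟨⟨eHomWhiskerLeft V X e'.inv, by rw [← eHomWhiskerLeft_comp]; simp⟩⟩
  rw [← cancel_epi (eHomWhiskerLeft V X e'.hom), ← cancel_epi (eHomWhiskerRight V e.inv Y')]
  calc
    _ = (EG.ehom X' Y' ≫ eHomWhiskerRight V σ' (G.obj Y')) ≫
        eHomWhiskerRight V (F.map e.inv) (G.obj Y') ≫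
        eHomWhiskerLeft V (F.obj X) (G.map e'.hom) := by
      rw [← Category.assoc (eHomWhiskerLeft _ _ _), EG.whiskerLeft_ehom, Category.assoc,
        ← Category.assoc (eHomWhiskerRight _ _ _), EG.whiskerRight_ehom, eHom_whisker_exchange,
        Category.assoc, Category.assoc, ← eHomWhiskerRight_comp_assoc,
        ← eHomWhiskerRight_comp_assoc, hσ']
    _ = (EF.ehom X' Y' ≫ eHomWhiskerRight V (F.map e.inv) (F.obj Y')) ≫
        eHomWhiskerLeft V (F.obj X) (τ' ≫ G.map e'.hom) := by
      rw [h, Category.assoc, Category.assoc, eHomWhiskerLeft_comp, ← eHom_whisker_exchange_assoc]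
    _ = _ := by
      rw [← hτ, ← EF.whiskerRight_ehom, eHomWhiskerLeft_comp, Category.assoc,
        ← Category.assoc (eHomWhiskerLeft _ _ _) (EF.ehom _ _), EF.whiskerLeft_ehom,
        Category.assoc]

/-- The inverse of an enriched natural isomorphism is enriched. -/
lemma IsEnriched.inv {EF : FunctorEnrichment V F} {EG : FunctorEnrichment V G} {e : F ≅ G}
    (he : IsEnriched EF EG e.hom) : IsEnriched EG EF e.inv := by
  intro X Y
  have hL : eHomWhiskerLeft V (F.obj X) (e.hom.app Y) ≫
      eHomWhiskerLeft V (F.obj X) (e.inv.app Y) = 𝟙 _ := by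
    rw [← eHomWhiskerLeft_comp, Iso.hom_inv_id_app, eHomWhiskerLeft_id]
  have hR : eHomWhiskerRight V (e.hom.app X) (G.obj Y) ≫
      eHomWhiskerRight V (e.inv.app X) (G.obj Y) = 𝟙 _ := by
    rw [← eHomWhiskerRight_comp, Iso.inv_hom_id_app, eHomWhiskerRight_id]
  rw [← Category.comp_id (EF.ehom X Y), ← hL, ← reassoc_of% (he X Y), Category.assoc,
    Category.assoc, eHom_whisker_exchange, reassoc_of% hR]

end Transformations

/-! ### A criterion for universality of Kleisli cocones -/

section Composition

open MonoidalCategory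

variable {V : Type u'} [Category.{v'} V] [MonoidalCategory V]
  {C : Type u₁} [Category.{v₁} C] [EnrichedOrdinaryCategory V C]
  {D : Type u₂} [Category.{v₂} D] [EnrichedOrdinaryCategory V D]

/-- If `c X : L (T X) ⟶ L X` is an enriched transformation compatible with the multiplication of
`T`, then `C(X, T Y) ⟶ D(L X, L (T Y)) ⟶ D(L X, L Y)` sends Kleisli composition to composition. -/
lemma MonadEnrichment.klComp_ehom_whiskerLeft {T : Monad C} (ET : MonadEnrichment V T) {L : C ⥤ D}
    (EL : FunctorEnrichment V L) (c : ∀ X, L.obj (T.obj X) ⟶ L.obj X) (X Y Z : C)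
    (hμ : L.map (muApp T Z) ≫ c Z = c (T.obj Z) ≫ c Z)
    (hc : EL.ehom Y (T.obj Z) ≫ eHomWhiskerRight V (c Y) (L.obj (T.obj Z)) =
      ET.endo.ehom Y (T.obj Z) ≫ EL.ehom (T.obj Y) (T.obj (T.obj Z)) ≫
        eHomWhiskerLeft V (L.obj (T.obj Y)) (c (T.obj Z))) :
    ET.klComp X Y Z ≫ EL.ehom X (T.obj Z) ≫ eHomWhiskerLeft V (L.obj X) (c Z) =
      ((EL.ehom X (T.obj Y) ≫ eHomWhiskerLeft V (L.obj X) (c Y)) ⊗ₘ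
        (EL.ehom Y (T.obj Z) ≫ eHomWhiskerLeft V (L.obj Y) (c Z))) ≫
        eComp V (L.obj X) (L.obj Y) (L.obj Z) := by
  have h₁ := EL.whiskerLeft_ehom X (muApp T Z)
  have h₂ := EL.ehom_comp X (T.obj Y) (T.obj (T.obj Z))
  have h₃ : eHomWhiskerLeft V (L.obj X) (L.map (muApp T Z)) ≫ eHomWhiskerLeft V (L.obj X) (c Z) =
      eHomWhiskerLeft V (L.obj X) (c (T.obj Z)) ≫ eHomWhiskerLeft V (L.obj X) (c Z) := by
    rw [← eHomWhiskerLeft_comp, ← eHomWhiskerLeft_comp, hμ]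
  calc
    _ = (X ⟶[V] T.obj Y) ◁ ET.endo.ehom Y (T.obj Z) ≫
        (EL.ehom X (T.obj Y) ⊗ₘ EL.ehom (T.obj Y) (T.obj (T.obj Z))) ≫ eComp V _ _ _ ≫
        eHomWhiskerLeft V (L.obj X) (c (T.obj Z)) ≫ eHomWhiskerLeft V (L.obj X) (c Z) := by
      rw [← h₃, ← reassoc_of% h₂, ← reassoc_of% h₁]
      simp only [MonadEnrichment.klComp, Category.assoc]
    _ = (X ⟶[V] T.obj Y) ◁ (ET.endo.ehom Y (T.obj Z) ≫ EL.ehom (T.obj Y) (T.obj (T.obj Z)) ≫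
          eHomWhiskerLeft V _ (c (T.obj Z))) ≫
        EL.ehom X (T.obj Y) ▷ _ ≫ eComp V _ _ _ ≫ eHomWhiskerLeft V (L.obj X) (c Z) := by
      rw [eComp_eHomWhiskerLeft_assoc, MonoidalCategory.tensorHom_def']
      simp only [MonoidalCategory.whiskerLeft_comp, Category.assoc,
        MonoidalCategory.whisker_exchange_assoc]
    _ = EL.ehom X (T.obj Y) ▷ _ ≫ _ ◁ EL.ehom Y (T.obj Z) ≫
        eHomWhiskerLeft V (L.obj X) (c Y) ▷ _ ≫ eComp V _ _ _ ≫
        eHomWhiskerLeft V (L.obj X) (c Z) := by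
      rw [← hc, ← reassoc_of% (eComp_dinatural (V := V) (L.obj X) (c Y) (L.obj (T.obj Z)))]
      simp only [MonoidalCategory.whiskerLeft_comp, Category.assoc,
        MonoidalCategory.whisker_exchange_assoc]
    _ = _ := by
      rw [eComp_eHomWhiskerLeft]
      simp only [MonoidalCategory.whiskerLeft_comp, Category.assoc,
        MonoidalCategory.tensorHom_def, comp_whiskerRight, MonoidalCategory.whisker_exchange_assoc]

end Composition

section Cocones

open MonoidalCategory

variable {V : Type u'} [Category.{v'} V] [MonoidalCategory V]

/-- Kleisli composition of a monad in `EnrichCat V`, as a morphism between hom-objects that are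
written in terms of the bicategorical data. -/
def BicatMonad.klComp (m : BicatMonad (EnrichCat.{v, u} V)) (X Y Z : m.ob.carrier) :
    (X ⟶[V] m.endo.functor.obj Y) ⊗ (Y ⟶[V] m.endo.functor.obj Z) ⟶
      (X ⟶[V] m.endo.functor.obj Z) :=
  m.enrichment.klComp X Y Z

namespace KleisliCocone

variable {m : BicatMonad (EnrichCat.{v, u} V)} (q : KleisliCocone m)

/-- The component `ℓ (T X) ⟶ ℓ X` of the 2-cell of a Kleisli cocone with leg `ℓ`. -/
def cellApp (X : m.ob.carrier) :
    q.leg.functor.obj (m.endo.functor.obj X) ⟶ q.leg.functor.obj X :=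
  q.cell.nat.app X

lemma map_unit_cellApp (X : m.ob.carrier) :
    q.leg.functor.map (m.unit.nat.app X) ≫ q.cellApp X = 𝟙 _ :=
  congrArg (fun τ => τ.nat.app X) q.unit_cell

lemma map_mult_cellApp (X : m.ob.carrier) :
    q.leg.functor.map (muApp m.toMonad X) ≫ q.cellApp X =
      q.cellApp (m.endo.functor.obj X) ≫ q.cellApp X := by
  have h : q.leg.functor.map (muApp m.toMonad X) ≫ q.cellApp X =
      𝟙 _ ≫ q.cellApp (m.endo.functor.obj X) ≫ q.cellApp X :=
    congrArg (fun τ => τ.nat.app X) q.mult_cell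
  rwa [Category.id_comp] at h

lemma ehom_cellApp (X Y : m.ob.carrier) :
    q.leg.enrichment.ehom X Y ≫ eHomWhiskerRight V (q.cellApp X) (q.leg.functor.obj Y) =
      m.endo.enrichment.ehom X Y ≫
        q.leg.enrichment.ehom (m.endo.functor.obj X) (m.endo.functor.obj Y) ≫
          eHomWhiskerLeft V (q.leg.functor.obj (m.endo.functor.obj X)) (q.cellApp Y) :=
  (q.cell.isEnriched X Y).trans (Category.assoc _ _ _)

/-- The action on hom-objects of the enriched functor from the Kleisli category with hom-objects
`C(X, T Y)` that is induced by a Kleisli cocone with leg `ℓ`: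
the composite `C(X, T Y) ⟶ D(ℓ X, ℓ (T Y)) ⟶ D(ℓ X, ℓ Y)`. -/
def descHom (X Y : m.ob.carrier) :
    (X ⟶[V] m.endo.functor.obj Y) ⟶ (q.leg.functor.obj X ⟶[V] q.leg.functor.obj Y) :=
  q.leg.enrichment.ehom X (m.endo.functor.obj Y) ≫
    eHomWhiskerLeft V (q.leg.functor.obj X) (q.cellApp Y)

lemma eHomEquiv_descHom {X Y : m.ob.carrier} (f : X ⟶ m.endo.functor.obj Y) :
    eHomEquiv V f ≫ q.descHom X Y = eHomEquiv V (q.leg.functor.map f ≫ q.cellApp Y) := by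
  rw [descHom, ← Category.assoc, ← q.leg.enrichment.homEquiv_map, eHomEquiv_whiskerLeft]

lemma unit_descHom (X : m.ob.carrier) :
    eHomEquiv V (m.unit.nat.app X) ≫ q.descHom X X = eId V (q.leg.functor.obj X) := by
  refine (q.eHomEquiv_descHom (m.unit.nat.app X)).trans ?_
  rw [← eHomEquiv_id]
  exact congrArg _ (q.map_unit_cellApp X)

/-- The leg factors through `descHom` by postcomposition with the unit of the monad. -/
lemma whiskerLeft_unit_descHom (X Y : m.ob.carrier) :
    eHomWhiskerLeft V X (m.unit.nat.app Y) ≫ q.descHom X Y = q.leg.enrichment.ehom X Y := by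
  have h := q.leg.enrichment.whiskerLeft_ehom X (m.unit.nat.app Y)
  rw [descHom]
  erw [reassoc_of% h]
  rw [← eHomWhiskerLeft_comp, map_unit_cellApp, eHomWhiskerLeft_id, Category.comp_id]
  rfl

lemma klComp_descHom (X Y Z : m.ob.carrier) :
    m.klComp X Y Z ≫ q.descHom X Z =
      (q.descHom X Y ⊗ₘ q.descHom Y Z) ≫ eComp V (q.leg.functor.obj X) (q.leg.functor.obj Y)
        (q.leg.functor.obj Z) :=
   m.enrichment.klComp_ehom_whiskerLeft q.leg.enrichment q.cellApp X Y Z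
    (q.map_mult_cellApp Z) (q.ehom_cellApp Y (m.endo.functor.obj Z))

section Universality

variable {k : KleisliCocone m}

/-- If the maps `descHom` of a cocone `k` are invertible, every cocone `q` induces a `V`-functor on
the full image of the leg of `k`. -/
noncomputable def descImage (hk : ∀ X Y, IsIso (k.descHom X Y)) :
    ImageFunctor V k.leg.functor.obj q.leg.functor.obj where
  ehom X Y := inv (k.descHom X Y) ≫ q.descHom X Y
  ehom_id X := by rw [← k.unit_descHom, Category.assoc, IsIso.hom_inv_id_assoc, unit_descHom]
  ehom_comp X Y Z := by
    rw [← cancel_epi (k.descHom X Y ⊗ₘ k.descHom Y Z), ← Category.assoc, ← klComp_descHom,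
      Category.assoc, IsIso.hom_inv_id_assoc, klComp_descHom, tensorHom_comp_tensorHom_assoc,
      IsIso.hom_inv_id_assoc, IsIso.hom_inv_id_assoc]

lemma ehom_descImage (hk : ∀ X Y, IsIso (k.descHom X Y)) (X Y : m.ob.carrier) :
    k.leg.enrichment.ehom X Y ≫ (q.descImage hk).ehom X Y = q.leg.enrichment.ehom X Y := by
  rw [← whiskerLeft_unit_descHom, ← whiskerLeft_unit_descHom, Category.assoc, descImage,
    IsIso.hom_inv_id_assoc]

/-- The cell of `k` at `X` corresponds under `descHom` to the identity of `T X`, and so does the cell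
of `q`. -/
lemma map_descImage_cellApp (hk : ∀ X Y, IsIso (k.descHom X Y)) (X : m.ob.carrier) :
    (q.descImage hk).map (k.cellApp X) = q.cellApp X := by
  have h (c : KleisliCocone m) : eHomEquiv V (𝟙 (m.endo.functor.obj X)) ≫ c.descHom _ X =
      eHomEquiv V (c.cellApp X) := by
    rw [eHomEquiv_descHom, CategoryTheory.Functor.map_id, Category.id_comp]
  apply (eHomEquiv V).injective
  rw [ImageFunctor.eHomEquiv_map, ← h, ← h, descImage, Category.assoc, IsIso.hom_inv_id_assoc]

/-- The one-dimensional universal property. The mediating 1-cell sends an object `A` to the value of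
the leg of `q` at a chosen `s A` with `ℓ (s A) ≅ A`, where `ℓ` is the leg of `k`. -/
lemma exists_mor_of_isIso_descHom (hk : ∀ X Y, IsIso (k.descHom X Y))
    [k.leg.functor.EssSurj] :
    ∃ (g : k.ob ⟶ q.ob) (c : k.leg ≫ g ≅ q.leg),
      (Bicategory.associator m.endo k.leg g).inv ≫ Bicategory.whiskerRight k.cell g ≫ c.hom =
        Bicategory.whiskerLeft m.endo c.hom ≫ q.cell := by
  let s := k.leg.functor.objPreimage
  let e := k.leg.functor.objObjPreimageIso
  let P := q.descImage hk
  let g : k.ob ⟶ q.ob := ⟨(P.extend s e).toFunctor, (P.extend s e).enrichment⟩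
  -- One computation gives both naturality and enriched naturality of the invertible 2-cell.
  have hc (X Y : m.ob.carrier) : q.leg.enrichment.ehom X Y ≫
      eHomWhiskerRight V (P.map (e (k.leg.functor.obj X)).hom) (q.leg.functor.obj Y) =
      (k.leg ≫ g).enrichment.ehom X Y ≫
        eHomWhiskerLeft V _ (P.map (e (k.leg.functor.obj Y)).hom) := by
    change _ = (k.leg.enrichment.ehom X Y ≫ eHomWhiskerRight V (e _).hom _ ≫
      eHomWhiskerLeft V _ (e _).inv ≫ P.ehom _ _) ≫
        eHomWhiskerLeft V (q.leg.functor.obj _) (P.map (e (k.leg.functor.obj Y)).hom)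
    rw [Category.assoc, Category.assoc, Category.assoc, ← P.whiskerLeft_ehom,
      ← eHomWhiskerLeft_comp_assoc, Iso.inv_hom_id, eHomWhiskerLeft_id, Category.id_comp,
      P.whiskerRight_ehom, ← q.ehom_descImage hk, Category.assoc]
  let c : (k.leg ≫ g).functor ≅ q.leg.functor :=
    NatIso.ofComponents (fun X => P.mapIso (e (k.leg.functor.obj X)))
      (fun f => naturality_of_ehom (k.leg ≫ g).enrichment q.leg.enrichment _ _ (hc _ _) f)
  have hc' : IsEnriched (k.leg ≫ g).enrichment q.leg.enrichment c.hom := hc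
  refine ⟨g, EnrichFunctor.isoMk c hc' hc'.inv, EnrichTrans.hom_ext fun X => ?_⟩
  change 𝟙 _ ≫ (P.extend s e).map (k.cellApp X) ≫ P.map (e _).hom =
    P.map (e _).hom ≫ q.cellApp X
  rw [Category.id_comp, P.extend_map, ← P.map_comp, ← q.map_descImage_cellApp hk, ← P.map_comp]
  simp

/-- A 2-cell out of the leg of a cocone that is compatible with the cell of the cocone is
`V`-natural on the full image of the leg, not only on the base category. -/
lemma ehom_naturality_of_isIso_descHom {x : EnrichCat.{v, u} V} {g₁ g₂ : k.ob ⟶ x}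
    (τ : k.leg ≫ g₁ ⟶ k.leg ≫ g₂) (X Y : m.ob.carrier) [IsIso (k.descHom X Y)]
    (hτ : g₁.functor.map (k.cellApp Y) ≫ τ.nat.app Y =
      τ.nat.app (m.endo.functor.obj Y) ≫ g₂.functor.map (k.cellApp Y)) :
    g₂.enrichment.ehom (k.leg.functor.obj X) (k.leg.functor.obj Y) ≫
        eHomWhiskerRight V (τ.nat.app X) (g₂.functor.obj (k.leg.functor.obj Y)) =
      g₁.enrichment.ehom (k.leg.functor.obj X) (k.leg.functor.obj Y) ≫
        eHomWhiskerLeft V (g₁.functor.obj (k.leg.functor.obj X)) (τ.nat.app Y) := by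
  have h : k.leg.enrichment.ehom X (m.endo.functor.obj Y) ≫ g₂.enrichment.ehom _ _ ≫
      eHomWhiskerRight V (τ.nat.app X) _ =
      k.leg.enrichment.ehom X (m.endo.functor.obj Y) ≫ g₁.enrichment.ehom _ _ ≫
        eHomWhiskerLeft V _ (τ.nat.app (m.endo.functor.obj Y)) :=
    (Category.assoc _ _ _).symm.trans
      ((τ.isEnriched X (m.endo.functor.obj Y)).trans (Category.assoc _ _ _))
  rw [← cancel_epi (k.descHom X Y), descHom, Category.assoc, Category.assoc,
    ← Category.assoc (eHomWhiskerLeft _ _ _), g₂.enrichment.whiskerLeft_ehom, Category.assoc,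
    ← Category.assoc (eHomWhiskerLeft _ _ _) (g₁.enrichment.ehom _ _),
    g₁.enrichment.whiskerLeft_ehom, Category.assoc]
  erw [eHom_whisker_exchange, reassoc_of% h]
  rw [← eHomWhiskerLeft_comp]
  erw [← eHomWhiskerLeft_comp]
  erw [hτ]

/-- The two-dimensional universal property. The component of the mediating 2-cell at `A` is forced to
be that of `τ` at a chosen `s A`, conjugated by `ℓ (s A) ≅ A`; its enriched naturality is transported
from the full image of the leg. -/
lemma existsUnique_cell_of_isIso_descHom (hk : ∀ X Y, IsIso (k.descHom X Y))
    [k.leg.functor.EssSurj] {x : EnrichCat.{v, u} V} {g₁ g₂ : k.ob ⟶ x} (τ : k.leg ≫ g₁ ⟶ k.leg ≫ g₂)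
    (hτ : ∀ X, g₁.functor.map (k.cellApp X) ≫ τ.nat.app X =
      τ.nat.app (m.endo.functor.obj X) ≫ g₂.functor.map (k.cellApp X)) :
    ∃! θ : g₁ ⟶ g₂, Bicategory.whiskerLeft k.leg θ = τ := by
  let s := k.leg.functor.objPreimage
  let e : ∀ A, k.leg.functor.obj (s A) ≅ A := k.leg.functor.objObjPreimageIso
  have hL (X Y : m.ob.carrier) := k.ehom_naturality_of_isIso_descHom τ X Y (hτ Y)
  let t (A : k.ob.carrier) : g₁.functor.obj A ⟶ g₂.functor.obj A :=
    g₁.functor.map (e A).inv ≫ τ.nat.app (s A) ≫ g₂.functor.map (e A).hom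
  have ht (A : k.ob.carrier) :
      g₁.functor.map (e A).hom ≫ t A = τ.nat.app (s A) ≫ g₂.functor.map (e A).hom := by
    simp [t, ← Functor.map_comp_assoc]
  have hθ (A B : k.ob.carrier) : g₂.enrichment.ehom A B ≫ eHomWhiskerRight V (t A) _ =
      g₁.enrichment.ehom A B ≫ eHomWhiskerLeft V _ (t B) :=
    ehom_naturality_of_iso g₁.enrichment g₂.enrichment (e A) (e B) (ht A) (ht B) (hL _ _)
  refine ⟨⟨⟨t, fun A B f => naturality_of_ehom g₁.enrichment g₂.enrichment _ _ (hθ A B) f⟩, hθ⟩,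
    EnrichTrans.hom_ext fun X => ?_, fun θ h => EnrichTrans.hom_ext fun A => ?_⟩
  · change t (k.leg.functor.obj X) = τ.nat.app X
    rw [← cancel_epi (g₁.functor.map (e (k.leg.functor.obj X)).hom), ht]
    exact (naturality_of_ehom g₁.enrichment g₂.enrichment _ _ (hL _ _) _).symm
  · rw [← cancel_epi (g₁.functor.map (e A).hom)]
    refine (θ.nat.naturality _).trans (Eq.trans ?_ (ht A).symm)
    rw [← h]
    rfl

/-- A Kleisli cocone with leg `ℓ` is universal as soon as `ℓ` is essentially surjective and the maps
`C(X, T Y) ⟶ D(ℓ X, ℓ Y)` are invertible. -/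
theorem isUniversal_of_isIso_descHom (k : KleisliCocone m) (hk : ∀ X Y, IsIso (k.descHom X Y))
    [k.leg.functor.EssSurj] : k.IsUniversal where
  exists_mor q := q.exists_mor_of_isIso_descHom hk
  existsUnique_cell x g₁ g₂ τ hτ := by
    refine k.existsUnique_cell_of_isIso_descHom hk τ fun X => ?_
    have h : 𝟙 _ ≫ g₁.functor.map (k.cellApp X) ≫ τ.nat.app X =
        τ.nat.app (m.endo.functor.obj X) ≫ 𝟙 _ ≫ g₂.functor.map (k.cellApp X) :=
      congrArg (fun σ => σ.nat.app X) hτ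
    rwa [Category.id_comp, Category.id_comp] at h

end Universality

end KleisliCocone

end Cocones

/-! ### The comparison functor and the Kleisli cocone -/

section Comparison

open MonoidalCategory

lemma isIso_of_comp_mono {V : Type u'} [Category.{v'} V] {W E Z : V} {l : W ⟶ E} (i : E ⟶ Z)
    [Mono i] {f : W ⟶ Z} (r : Z ⟶ W)
    (hl : l ≫ i = f) (hf : f ≫ r = 𝟙 W) (hi : i ≫ r ≫ f = i) : IsIso l :=
  ⟨i ≫ r, by rw [← Category.assoc, hl, hf], by
    rw [← cancel_mono i, Category.assoc, Category.assoc, hl, hi, Category.id_comp]⟩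

variable {V : Type u'} [Category.{v'} V] [MonoidalCategory V] [HasEqualizers V]

/-- The map `C(X, T Y) ⟶ C(T X, T (T Y)) ⟶ C(T X, T Y)` is an isomorphism onto the object of algebra
morphisms from `T X` to `T Y`; its inverse is precomposition with the unit `X ⟶ T X`. -/
lemma MonadEnrichment.isIso_comparison_ehom {C : Type u₁} [Category.{v₁} C]
    [EnrichedOrdinaryCategory V C] {T : Monad C} (ET : MonadEnrichment V T) (X Y : Kleisli T) :
    letI := ET.em; letI := ET.naiveKleisli
    IsIso (ET.comparison.ehom X Y) := by
  refine isIso_of_comp_mono (E := ET.emHom (T.free.obj X.of) (T.free.obj Y.of))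
    (ET.emι (T.free.obj X.of) (T.free.obj Y.of))
    (eHomWhiskerRight V (T.η.app X.of) (T.obj Y.of))
    (ET.emLift_emι (A := T.free.obj X.of) (B := T.free.obj Y.of) _
      (ET.comparison_condition X.of Y.of)) ?_ ?_
  · erw [Category.assoc, eHom_whisker_exchange, ← Category.assoc, ET.unit_condition]
    refine (eHomWhiskerLeft_comp V X.of _ _).symm.trans ?_
    rw [unit_muApp]
    exact eHomWhiskerLeft_id V _ _
  · have hη := ET.endo.whiskerRight_ehom (T.η.app X.of) (T.obj Y.of)
    have hc := ET.emι_condition (T.free.obj X.of) (T.free.obj Y.of)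
    have he : eHomWhiskerRight V (muApp T X.of) (T.obj Y.of) ≫
        eHomWhiskerRight V (T.map (T.η.app X.of)) (T.obj Y.of) = 𝟙 _ := by
      rw [← eHomWhiskerRight_comp, map_unit_muApp]
      exact eHomWhiskerRight_id V _ _
    have hx : eHomWhiskerRight V (T.η.app X.of) (T.obj Y.of) ≫
        ET.endo.ehom X.of (T.obj Y.of) ≫ eHomWhiskerLeft V (T.obj X.of) (muApp T Y.of) =
        (ET.endo.ehom (T.obj X.of) (T.obj Y.of) ≫
          eHomWhiskerLeft V (T.obj (T.obj X.of)) (muApp T Y.of)) ≫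
            eHomWhiskerRight V (T.map (T.η.app X.of)) (T.obj Y.of) := by
      rw [Category.assoc, eHom_whisker_exchange, ← Category.assoc, ← Category.assoc]
      exact hη =≫ _
    refine (_ ≫= hx).trans ((Category.assoc _ _ _).symm.trans ((hc =≫ _).trans ?_))
    exact (Category.assoc _ _ _).trans ((_ ≫= he).trans (Category.comp_id _))

variable (m : BicatMonad (EnrichCat.{v, max u v} V))

/-- The functor on `C(X, T Y)` induced by the Kleisli cocone is the comparison functor. -/
lemma descHom_kleisliCocone (X Y : m.ob.carrier) :
    letI := m.enrichment.em; letI := m.enrichment.naiveKleisli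
    (kleisliCocone.{v, u} m).descHom X Y =
      m.enrichment.comparison.ehom (Kleisli.mk m.toMonad X) (Kleisli.mk m.toMonad Y) := by
  let := m.enrichment.em
  refine (cancel_mono (m.enrichment.emι (m.toMonad.free.obj X) (m.toMonad.free.obj Y))).1 ?_
  refine Eq.trans ?_ (m.enrichment.emLift_emι _ _).symm
  refine (Category.assoc _ _ _).trans
    ((_ ≫= m.enrichment.em_whiskerLeft (m.toMonad.free.obj X) ((freeMult m.toMonad).app Y)).trans ?_)
  exact (Category.assoc _ _ _).symm.trans (m.enrichment.emLift_emι _ _ =≫ _)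

instance : (kleisliLeg.{v, u} m).functor.EssSurj where
  mem_essImage A := by
    obtain ⟨X, ⟨e⟩⟩ := A.property
    exact ⟨X, ⟨ObjectProperty.isoMk _ e⟩⟩

theorem isUniversal_kleisliCocone : (kleisliCocone.{v, u} m).IsUniversal :=
  haveI : (kleisliCocone.{v, u} m).leg.functor.EssSurj :=
    inferInstanceAs (kleisliLeg.{v, u} m).functor.EssSurj
  (kleisliCocone.{v, u} m).isUniversal_of_isIso_descHom fun X Y => by
    rw [descHom_kleisliCocone]
    exact m.enrichment.isIso_comparison_ehom _ _

theorem isWeakEquivalence_kleisliComparison :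
    (kleisliComparison.{v, u} m).IsWeakEquivalence where
  isIso_ehom X Y := m.enrichment.isIso_comparison_ehom X Y
  essSurj :=
    { mem_essImage A := by
        obtain ⟨X, ⟨e⟩⟩ := A.property
        exact ⟨Kleisli.mk _ X, ⟨ObjectProperty.isoMk _ e⟩⟩ }

end Comparison

/-! ### Univalence -/

section Univalence

/-- If every isomorphism of the base category comes from an equality of objects, the same holds for
algebras: the underlying isomorphism becomes an identity, and an algebra morphism over an identity
forces the two structure maps to agree. -/
lemma algebra_eqToIso_surjective {C : Type u₁} [Category.{v₁} C] (T : Monad C)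
    (hC : ∀ X Y : C, Function.Surjective (fun h : X = Y => eqToIso h)) (A B : T.Algebra) :
    Function.Surjective (fun h : A = B => eqToIso h) := by
  intro e
  obtain ⟨X, a, ha, ha'⟩ := A
  obtain ⟨Y, b, hb, hb'⟩ := B
  obtain ⟨h, he⟩ := hC _ _ (T.forget.mapIso e)
  obtain rfl : X = Y := h
  have hf : e.hom.f = 𝟙 X := (congrArg Iso.hom he).symm
  have hab : T.map e.hom.f ≫ b = a ≫ e.hom.f := e.hom.h
  rw [hf, T.map_id, Category.id_comp, Category.comp_id] at hab
  obtain rfl : b = a := hab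
  refine ⟨rfl, ?_⟩
  ext
  exact hf.symm

lemma fullSubcategory_eqToIso_surjective {C : Type u₁} [Category.{v₁} C] (P : ObjectProperty C)
    (hC : ∀ X Y : C, Function.Surjective (fun h : X = Y => eqToIso h))
    (A B : P.FullSubcategory) : Function.Surjective (fun h : A = B => eqToIso h) := by
  intro e
  obtain ⟨X, hX⟩ := A
  obtain ⟨Y, hY⟩ := B
  obtain ⟨h, he⟩ := hC _ _ (P.ι.mapIso e)
  obtain rfl : X = Y := h
  exact ⟨rfl, Iso.ext (ObjectProperty.hom_ext _ (congrArg Iso.hom he))⟩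

variable {V : Type u'} [Category.{v'} V] [MonoidalCategory V]

lemma isUnivalent_kleisli [HasEqualizers V] (m : BicatMonad (EnrichCat.{v, max u v} V))
    (h : m.ob.IsUnivalent) : (kleisli.{v, u} m).IsUnivalent := fun A B =>
  ⟨fun _ _ _ => rfl, fullSubcategory_eqToIso_surjective m.toMonad.free.essImage
    (algebra_eqToIso_surjective m.toMonad fun X Y => (h X Y).2) A B⟩

end Univalence

/-! ### Kleisli cocones in full sub-bicategories -/

section Induced

open Bicategory

variable {A : Type u₁} {B : Type u} [Bicategory.{w, v} B] {F : A → B}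

/-- A Kleisli cocone in a full sub-bicategory, from the data of one in the ambient bicategory. The
data are taken unbundled, so that the vertex is literally `F K` and no transport along an equality of
objects occurs. -/
def KleisliCocone.toInduced (m : BicatMonad (InducedBicategory B F)) (K : A)
    (leg : m.ofInduced.ob ⟶ F K) (cell : m.ofInduced.endo ≫ leg ⟶ leg)
    (hu : m.ofInduced.unit ▷ leg ≫ cell = (λ_ leg).hom)
    (hm : m.ofInduced.mult ▷ leg ≫ cell =
      (α_ m.ofInduced.endo m.ofInduced.endo leg).hom ≫ m.ofInduced.endo ◁ cell ≫ cell) :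
    KleisliCocone m where
  ob := K
  leg := InducedBicategory.mkHom leg
  cell := ⟨cell⟩
  unit_cell := InducedBicategory.hom₂_ext hu
  mult_cell := InducedBicategory.hom₂_ext hm

/-- A Kleisli cocone in a full sub-bicategory, regarded as one in the ambient bicategory. -/
def KleisliCocone.ofInduced {m : BicatMonad (InducedBicategory B F)} (k : KleisliCocone m) :
    KleisliCocone m.ofInduced where
  ob := F k.ob
  leg := k.leg.hom
  cell := k.cell.hom
  unit_cell := congrArg InducedBicategory.Hom₂.hom k.unit_cell
  mult_cell := congrArg InducedBicategory.Hom₂.hom k.mult_cell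

/-- A full sub-bicategory reflects universality of Kleisli cocones. -/
lemma KleisliCocone.IsUniversal.of_ofInduced {m : BicatMonad (InducedBicategory B F)}
    {k : KleisliCocone m} (hk : k.ofInduced.IsUniversal) : k.IsUniversal where
  exists_mor q := by
    obtain ⟨g, c, h⟩ := hk.exists_mor q.ofInduced
    exact ⟨InducedBicategory.mkHom g, InducedBicategory.isoMk c, InducedBicategory.hom₂_ext h⟩
  existsUnique_cell x g₁ g₂ τ hτ := by
    obtain ⟨θ, h, hθ⟩ := hk.existsUnique_cell (F x) g₁.hom g₂.hom τ.hom
      (congrArg InducedBicategory.Hom₂.hom hτ)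
    exact ⟨⟨θ⟩, InducedBicategory.hom₂_ext h, fun θ' h' =>
      InducedBicategory.hom₂_ext (hθ _ (congrArg InducedBicategory.Hom₂.hom h'))⟩

end Induced

end EnrichedKleisli

theorem mainTheorem5 {V : Type u'} [Category.{v'} V] [MonoidalCategory V] [HasEqualizers V] :
    (∀ m : BicatMonad (EnrichCat.{v, max u v} V),
      (kleisliCocone.{v, u} m).IsUniversal ∧
      (kleisliComparison.{v, u} m).IsWeakEquivalence ∧
      (m.ob.IsUnivalent → (kleisli.{v, u} m).IsUnivalent)) ∧
    (∀ m : BicatMonad (UnivEnrichCat.{v, max u v} V),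
      ∃ k : KleisliCocone m, k.ob.1 = kleisli.{v, u} m.ofInduced ∧ k.IsUniversal) ∧
    HasKleisliObjects (EnrichCat.{v, max u v} V) ∧
    HasKleisliObjects (UnivEnrichCat.{v, max u v} V) := by
  have hU (m : BicatMonad (UnivEnrichCat.{v, max u v} V)) :
      ∃ k : KleisliCocone m, k.ob.1 = kleisli.{v, u} m.ofInduced ∧ k.IsUniversal := by
    let c := kleisliCocone.{v, u} m.ofInduced
    let k : KleisliCocone m := KleisliCocone.toInduced m
      ⟨kleisli.{v, u} m.ofInduced, isUnivalent_kleisli m.ofInduced m.ob.2⟩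
      c.leg c.cell c.unit_cell c.mult_cell
    exact ⟨k, rfl, .of_ofInduced (isUniversal_kleisliCocone m.ofInduced)⟩
  exact ⟨fun m => ⟨isUniversal_kleisliCocone m, isWeakEquivalence_kleisliComparison m,
    isUnivalent_kleisli m⟩, hU, fun m => ⟨_, isUniversal_kleisliCocone m⟩, fun m =>
    let ⟨k, _, hk⟩ := hU m
    ⟨k, hk⟩⟩
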